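/- Let $F$ be a field and let $A$ be a finite-dimensional central simple $F$-algebra, so that its center $Z$ equals $F$. Let $*$ be an involution on $A$, that is, an additive map $A\to A$ with $(ab)^*=b^*a^*$ and $(a^*)^*=a$ for all $a,b\in A$ (it need not be $F$-linear). Put $S=\{a\in A: a^*=a\}$ and $K=\{a\in A: a^*=-a\}$, and for subsets $U,V\subseteq A$ let $[U,V]$ denote the $F$-linear span of all commutators $uv-vu$ with $u\in U$, $v\in V$. The involution is of the first kind if it fixes $Z$ pointwise, and of the second kind otherwise. Let $L$ be a Lie skew-ideal of $A$, that is, an $F$-linear subspace of $A$ with $[L,K]\subseteq L$. (1) Suppose $*$ is of the first kind. If $\dim_Z A\neq 4,16$ and $\operatorname{char}(F)\neq 2,3$, then $L$ is one of $0$, $Z$, $K$, $[S,K]$, $S$, $Z+K$, $[A,A]$, $A$. (2) Suppose $*$ is of the second kind. If $\operatorname{char}(F)\neq 2$, then $L$ is one of $0$, $Z$, $[A,A]$, $A$. -/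

import Mathlib

/-- An involution `*` on a ring `A` is of the first kind if it fixes the center pointwise. -/
def IsFirstKind (A : Type*) [Ring A] [StarRing A] : Prop :=
  ∀ z ∈ Subring.center A, star z = z

/-- An involution is of the second kind if it is not of the first kind. -/
def IsSecondKind (A : Type*) [Ring A] [StarRing A] : Prop :=
  ¬ IsFirstKind A

/-- `[U, V]`: the `F`-linear span of all commutators `u * v - v * u`, `u ∈ U`, `v ∈ V`. -/
def commSpan (F : Type*) {A : Type*} [Field F] [Ring A] [Algebra F A] (U V : Set A) :
    Submodule F A :=
  Submodule.span F {x : A | ∃ u ∈ U, ∃ v ∈ V, x = u * v - v * u}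

/-- A linear subspace `L` of an algebra with involution is a Lie skew-ideal if `[L, K] ⊆ L`,
where `K = skewAdjoint A` is the set of skew-symmetric elements. -/
def IsLieSkewIdeal {F A : Type*} [Field F] [Ring A] [Algebra F A] [StarRing A]
    (L : Submodule F A) : Prop :=
  ∀ x ∈ L, ∀ k ∈ skewAdjoint A, x * k - k * x ∈ L

/-!
A Lie skew-ideal `L` is a submodule of `A` under the Lie ring `K` of skew elements, and the theorem
says that `A` has very few submodules. Subspaces of `A` can be compared after extending scalars to
an algebraic closure `E` of `F`: there `A` becomes `M_n(E)` (`exists_splitting`), and `L` is the set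
of elements of `A` lying in the `E`-span of `L` (`IsScalarExtension.mem_span_image_iff`). So only
matrices have to be considered.

*Second kind.* There is a central skew `λ ≠ 0`, and then `λ S ⊆ K`, so `L` is stable under
commutators with `S + K = A`: it is a Lie ideal. A Lie ideal of `M_n(E)` with a non-scalar element
contains some matrix unit `E_ij`, `i ≠ j`, hence all trace zero matrices
(`lieIdeal_classification`).

*First kind.* The involution is `F`-linear and extends to an `E`-linear involution `τ` of `M_n(E)`.
Automorphisms of `M_n(E)` are inner and symmetric matrices over `E` have the form `h hᵀ`, so `τ` is
the transpose in a suitable basis, or `a ↦ H⁻¹ aᵀ H` with `Hᵀ = -H`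
(`Matrix.involution_classification`). In both cases, for `n ≥ 3` and, with the transpose, `n ≠ 4`,
the stable subspaces `W` obey a dichotomy (`HasSkewStableDichotomy`): if `W ⊄ S` then `K ⊆ W`; if `W ⊆ S` is not scalar then `[S, K] ⊆ W`; and
`[S, K]` has codimension at most one in `S`. The list of eight subspaces is a formal consequence
(`HasSkewStableDichotomy.classification`).

* For the transpose, put `e = E_ij - E_ji ∈ K`. The operator `(ad e)⁴ + (ad e)²` is `12` times the
  projection of the block of rows and columns `i, j` to its symmetric trace zero part; this is where
  characteristic `3` has to be excluded (`IsSkewStable.block_mem`). The operator `-(ad e)²`, applied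
  to skew matrices, keeps exactly the entries with one index in `{i, j}`; for `n = 3` and `n ≥ 5`
  compositions of such operators isolate a single entry, which gives the simplicity of `K`
  (`IsSkewStable.skewPart_le_of_skew`). For `n = 4` they cannot separate `E_12 - E_21` from
  `E_34 - E_43`, as `𝔰𝔬₄` is not simple.
* For `Hᵀ = -H`, write matrices as `m H`; then `K` is spanned by the `z zᵀ H`, which square to zero.
  Taking the commutator with `p = z zᵀ H` twice maps `a` to `-2 p a p`, a multiple of `p`, and this
  gives `K ⊆ W` unless `W ⊆ S` (`IsGramStable.mem_of_transpose_eq`). On `S`, spanned by the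
  `(x yᵀ - y xᵀ) H`, single commutators with the `z zᵀ H` move any `x ∧ y` with `x ⊥ y` to any other
  (`IsGramStable.all_wedge_mem`).
-/

/-! ### Splitting a central simple algebra over an algebraically closed field -/

section Splitting

open scoped TensorProduct

/-- Two-sided multiplications exhaust the linear endomorphisms of a central simple algebra: `A` is a
simple module over the multiplication algebra, with commutant the centre `F`, and the density
theorem applies. -/
theorem mulLeftRight_surjective (F A : Type*) [Field F] [Ring A] [Algebra F A]
    [FiniteDimensional F A] [Algebra.IsCentral F A] [IsSimpleRing A] :
    Function.Surjective (AlgHom.mulLeftRight F A) := by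
  set M := (AlgHom.mulLeftRight F A).range with hM
  have hl : ∀ a b : A, ∃ m : M, ∀ x : A, m • x = a * x * b := fun a b =>
    ⟨⟨AlgHom.mulLeftRight F A (a ⊗ₜ MulOpposite.op b), ⟨_, rfl⟩⟩, fun x => by
      simp [Subalgebra.smul_def]⟩
  have hsimple : IsSimpleModule M A := by
    refine { exists_pair_ne := ⟨⊥, ⊤, bot_ne_top⟩, eq_bot_or_eq_top := fun N => ?_ }
    let I : TwoSidedIdeal A := TwoSidedIdeal.mk' (N : Set A) N.zero_mem
      (fun h1 h2 => N.add_mem h1 h2) (fun {x} h => by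
        obtain ⟨m, hm⟩ := hl (-1) 1
        simpa [hm] using N.smul_mem m h)
      (fun {x y} h => by
        obtain ⟨m, hm⟩ := hl x 1
        simpa [hm] using N.smul_mem m h)
      (fun {x y} h => by
        obtain ⟨m, hm⟩ := hl 1 y
        simpa [hm] using N.smul_mem m h)
    have hI : ∀ x, x ∈ I ↔ x ∈ N := fun x => by
      simp [I]
    rcases eq_bot_or_eq_top I with h | h
    · left
      rw [eq_bot_iff]
      intro x hx
      rw [← hI, h] at hx
      simpa using hx
    · right
      rw [eq_top_iff]
      intro x _
      rw [← hI, h]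
      trivial
  classical
  intro g
  have hcomm : ∀ f : Module.End M A, ∃ c : F, ∀ x, f x = c • x := by
    intro f
    have h1 : ∀ a, f a = a * f 1 := fun a => by
      obtain ⟨m, hm⟩ := hl a 1
      have := f.map_smul m 1
      simpa [hm] using this
    have h2 : ∀ a, f a = f 1 * a := fun a => by
      obtain ⟨m, hm⟩ := hl 1 a
      have := f.map_smul m 1
      simpa [hm] using this
    have hc : f 1 ∈ Subalgebra.center F A := by
      rw [Subalgebra.mem_center_iff]
      intro b
      rw [← h1, h2]
    obtain ⟨c, hc⟩ := Algebra.IsCentral.out hc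
    refine ⟨c, fun x => ?_⟩
    rw [h2, Algebra.smul_def, ← hc]
    rfl
  let g' : Module.End (Module.End M A) A :=
    { toFun := g
      map_add' := map_add g
      map_smul' := fun f x => by
        obtain ⟨c, hc⟩ := hcomm f
        simp [hc] }
  let b := Module.finBasis F A
  obtain ⟨⟨_, t, rfl⟩, hr⟩ := jacobson_density (R := M) g' (Finset.univ.image b)
  refine ⟨t, b.ext fun i => ?_⟩
  exact (hr (b i) (by simp)).symm

/-- A scalar extension of a central simple algebra is simple. A nonzero two-sided ideal of `E ⊗ A`
is stable under all `id ⊗ g`, and a suitable `g` of rank one turns a nonzero element into a nonzero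
multiple of `1`. -/
theorem isSimpleRing_tensorProduct (F E A : Type*) [Field F] [Field E] [Algebra F E] [Ring A]
    [Algebra F A] [FiniteDimensional F A] [Algebra.IsCentral F A] [IsSimpleRing A] :
    IsSimpleRing (E ⊗[F] A) := by
  refine ⟨{ exists_pair_ne := ⟨⊥, ⊤, bot_ne_top⟩, eq_bot_or_eq_top := fun I => ?_ }⟩
  rw [or_iff_not_imp_left]
  intro hI
  obtain ⟨t, ht, ht0⟩ : ∃ t ∈ I, t ≠ 0 := by
    by_contra! h
    exact hI (le_antisymm (fun x hx => by simpa using h x hx) bot_le)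
  have key : ∀ g : Module.End F A, g.baseChange E t ∈ I := by
    intro g
    obtain ⟨u, rfl⟩ := mulLeftRight_surjective F A g
    induction u using TensorProduct.induction_on with
    | zero => simp
    | add x y hx hy => simpa [LinearMap.baseChange_add] using I.add_mem hx hy
    | tmul a c =>
      have : (AlgHom.mulLeftRight F A (a ⊗ₜ c)).baseChange E t
          = (1 ⊗ₜ a) * t * (1 ⊗ₜ c.unop) := by
        clear ht ht0
        induction t using TensorProduct.induction_on with
        | zero => simp
        | add x y hx hy => simp [mul_add, add_mul, hx, hy]
        | tmul x y => simp
      rw [this]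
      exact I.mul_mem_right _ _ (I.mul_mem_left _ _ ht)
  let b := Module.finBasis F A
  let B := Algebra.TensorProduct.basis E b
  obtain ⟨i, hi⟩ : ∃ i, B.repr t i ≠ 0 := by
    by_contra! h
    exact ht0 (B.repr.map_eq_zero_iff.1 (Finsupp.ext h))
  have h1 := key ((b.coord i).smulRight 1)
  have h2 : ((b.coord i).smulRight (1 : A)).baseChange E t = B.repr t i • (1 : E ⊗[F] A) := by
    clear hi h1 key ht ht0
    induction t using TensorProduct.induction_on with
    | zero => simp
    | add x y hx hy => simp [hx, hy, add_smul]
    | tmul x y =>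
      simp [B, Algebra.TensorProduct.one_def, TensorProduct.smul_tmul', TensorProduct.tmul_smul]
      rw [Algebra.smul_def, mul_comm]
  rw [h2] at h1
  have h3 : (1 : E ⊗[F] A) ∈ I := by
    have := I.mul_mem_left (algebraMap E (E ⊗[F] A) (B.repr t i)⁻¹) _ h1
    rwa [← Algebra.smul_def, smul_smul, inv_mul_cancel₀ hi, one_smul] at this
  exact (TwoSidedIdeal.one_mem_iff I).1 h3

/-- A finite-dimensional central simple algebra becomes a matrix algebra over an algebraic closure.
The linear retraction `ρ` onto `A` lets subspaces of `A` be recovered from the `E`-subspaces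
they span, and any `F`-linear endomorphism of `A` extends `E`-linearly. -/
theorem exists_splitting (F E A : Type*) [Field F] [Field E] [Algebra F E] [IsAlgClosed E] [Ring A]
    [Algebra F A] [FiniteDimensional F A] [Algebra.IsCentral F A] [IsSimpleRing A] :
    ∃ (n : ℕ) (ι : A →ₐ[F] Matrix (Fin n) (Fin n) E) (r : E →ₗ[F] F)
      (ρ : Matrix (Fin n) (Fin n) E →ₗ[F] A),
      n * n = Module.finrank F A ∧ r 1 = 1 ∧
      Submodule.span E (Set.range ι) = ⊤ ∧ (∀ (e : E) (a : A), ρ (e • ι a) = r e • a) ∧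
      ∀ f : A →ₗ[F] A, ∃ τ : Matrix (Fin n) (Fin n) E →ₗ[E] Matrix (Fin n) (Fin n) E,
        ∀ a, τ (ι a) = ι (f a) := by
  have := isSimpleRing_tensorProduct F E A
  obtain ⟨n, hn, ⟨φ⟩⟩ := IsSimpleRing.exists_algEquiv_matrix_of_isAlgClosed E (E ⊗[F] A)
  obtain ⟨r, hr⟩ : ∃ r : E →ₗ[F] F, r 1 = 1 := by
    obtain ⟨r, hr⟩ := LinearMap.exists_leftInverse_of_injective (Algebra.linearMap F E)
      (LinearMap.ker_eq_bot.2 (algebraMap F E).injective)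
    exact ⟨r, by simpa using congr($hr 1)⟩
  let ι : A →ₐ[F] Matrix (Fin n) (Fin n) E :=
    (φ.toAlgHom.restrictScalars F).comp Algebra.TensorProduct.includeRight
  have hι : ∀ a, ι a = φ (1 ⊗ₜ a) := fun a => rfl
  have hφ : ∀ (e : E) (a : A), φ (e ⊗ₜ a) = e • ι a := fun e a => by
    rw [hι, ← map_smul, TensorProduct.smul_tmul', smul_eq_mul, mul_one]
  refine ⟨n, ι, r, (TensorProduct.lid F A).toLinearMap ∘ₗ (r.rTensor A) ∘ₗ
    (φ.symm.toLinearMap.restrictScalars F), ?_, hr, ?_, ?_, ?_⟩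
  · have h1 := φ.toLinearEquiv.finrank_eq
    rw [Module.finrank_baseChange] at h1
    simp [h1, Module.finrank_matrix]
  · rw [eq_top_iff]
    intro x _
    obtain ⟨t, rfl⟩ := φ.surjective x
    induction t using TensorProduct.induction_on with
    | zero => simp
    | add x y hx hy =>
      rw [map_add]
      exact Submodule.add_mem _ (hx trivial) (hy trivial)
    | tmul e a =>
      rw [hφ]
      exact Submodule.smul_mem _ _ (Submodule.subset_span ⟨a, rfl⟩)
  · intro e a
    simp [← hφ]
  · intro f
    refine ⟨φ.toLinearMap ∘ₗ f.baseChange E ∘ₗ φ.symm.toLinearMap, fun a => ?_⟩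
    simp [hι]

end Splitting

/-! ### Involutions of matrix algebras -/

section MatrixInvolutions

open Matrix

theorem Matrix.exists_smul_one_of_commute {E : Type*} [Field E] {n : ℕ}
    (C : Matrix (Fin n) (Fin n) E) (h : ∀ a, C * a = a * C) : ∃ c : E, C = c • 1 := by
  have : C ∈ Subalgebra.center E (Matrix (Fin n) (Fin n) E) := by
    rw [Subalgebra.mem_center_iff]
    exact fun b => (h b).symm
  obtain ⟨c, hc⟩ := Algebra.IsCentral.out this
  exact ⟨c, by rw [← hc, ← Algebra.algebraMap_eq_smul_one]; rfl⟩

/-- The Skolem–Noether theorem for matrix algebras. -/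
theorem Matrix.algEquiv_eq_conj {E : Type*} [Field E] {n : ℕ}
    (α : Matrix (Fin n) (Fin n) E ≃ₐ[E] Matrix (Fin n) (Fin n) E) :
    ∃ P Q : Matrix (Fin n) (Fin n) E, P * Q = 1 ∧ Q * P = 1 ∧ ∀ a, α a = P * a * Q := by
  let e := Matrix.toLinAlgEquiv' (R := E) (n := Fin n)
  obtain ⟨T, hT⟩ := ((e.symm.trans α).trans e).eq_linearEquivConjAlgEquiv
  refine ⟨e.symm T.toLinearMap, e.symm T.symm.toLinearMap, ?_, ?_, fun a => ?_⟩
  · rw [← map_mul, ← map_one e.symm]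
    congr 1
    ext; simp
  · rw [← map_mul, ← map_one e.symm]
    congr 1
    ext; simp
  · apply e.injective
    have := congr($hT (e a))
    simp only [AlgEquiv.trans_apply, AlgEquiv.symm_apply_apply] at this
    rw [this]
    simp only [map_mul, AlgEquiv.apply_symm_apply]
    ext
    simp [LinearEquiv.conjAlgEquiv_apply]

/-- Over an algebraically closed field every symmetric matrix, singular or not, has the form
`h hᵀ`. -/
theorem Matrix.exists_mul_transpose_eq {E : Type*} [Field E] [IsAlgClosed E] (h2 : (2 : E) ≠ 0)
    {n : ℕ} (P : Matrix (Fin n) (Fin n) E) (hP : Pᵀ = P) :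
    ∃ h : Matrix (Fin n) (Fin n) E, h * hᵀ = P := by
  have : Invertible (2 : E) := invertibleOfNonzero h2
  obtain ⟨v0, hv0⟩ := LinearMap.BilinForm.exists_orthogonal_basis (B := Matrix.toBilin' P)
    ⟨fun x y => by
      rw [Matrix.toBilin'_apply', Matrix.toBilin'_apply', dotProduct_mulVec, ← mulVec_transpose, hP,
        dotProduct_comm]
      rfl⟩
  obtain ⟨v, hv⟩ : ∃ v : Module.Basis (Fin n) E (Fin n → E),
      ∀ i j, i ≠ j → v i ⬝ᵥ P *ᵥ v j = 0 := by
    refine ⟨v0.reindex (finCongr (by simp)), fun i j hij => ?_⟩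
    have := hv0 (i := (finCongr (by simp)).symm i) (j := (finCongr (by simp)).symm j)
      (by simpa using hij)
    simpa [LinearMap.IsOrthoᵢ, Matrix.toBilin'_apply', Function.onFun] using this
  let b := Pi.basisFun E (Fin n)
  let V := b.toMatrix v
  let W := v.toMatrix b
  have hVW : V * W = 1 := b.toMatrix_mul_toMatrix_flip v
  choose s hs using fun i => IsAlgClosed.exists_pow_nat_eq (v i ⬝ᵥ P *ᵥ v i) (n := 2) (by simp)
  have hD : Vᵀ * P * V = diagonal s * diagonal s := by
    ext i j
    have h1 : (Vᵀ * P * V) i j = v i ⬝ᵥ P *ᵥ v j := by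
      rw [Matrix.mul_assoc]
      simp only [Matrix.mul_apply, dotProduct, mulVec, transpose_apply]
      rfl
    rw [h1, diagonal_mul_diagonal]
    by_cases hij : i = j
    · subst hij
      simp [← hs, sq]
    · rw [hv i j hij, diagonal_apply_ne _ hij]
  refine ⟨Wᵀ * diagonal s, ?_⟩
  rw [transpose_mul, diagonal_transpose, transpose_transpose, Matrix.mul_assoc,
    ← Matrix.mul_assoc (diagonal s), ← hD]
  have hWV : Wᵀ * Vᵀ = 1 := by rw [← transpose_mul, hVW, transpose_one]
  calc Wᵀ * (Vᵀ * P * V * W) = (Wᵀ * Vᵀ) * P * (V * W) := by simp only [Matrix.mul_assoc]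
    _ = P := by rw [hWV, hVW, one_mul, mul_one]

/-- Over an algebraically closed field a linear involution of a matrix algebra is conjugate to the
transpose, or it is the adjunction of an alternating form. -/
theorem Matrix.involution_classification {E : Type*} [Field E] [IsAlgClosed E] (h2 : (2 : E) ≠ 0)
    {n : ℕ} (τ : Matrix (Fin n) (Fin n) E →ₗ[E] Matrix (Fin n) (Fin n) E)
    (hmul : ∀ a b, τ (a * b) = τ b * τ a) (hone : τ 1 = 1) (hinv : ∀ a, τ (τ a) = a) :
    (∃ h k : Matrix (Fin n) (Fin n) E, h * k = 1 ∧ k * h = 1 ∧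
      ∀ a, k * τ a * h = (k * a * h)ᵀ) ∨
    ∃ G H : Matrix (Fin n) (Fin n) E, G * H = 1 ∧ H * G = 1 ∧ Hᵀ = -H ∧
      ∀ a, τ a = G * aᵀ * H := by
  let α : Matrix (Fin n) (Fin n) E ≃ₐ[E] Matrix (Fin n) (Fin n) E :=
    AlgEquiv.ofBijective (AlgHom.ofLinearMap (τ ∘ₗ (transposeLinearEquiv _ _ E E).toLinearMap)
      (by simpa using hone) (by simp [hmul]))
      (by
        refine ⟨fun a b hab => ?_, fun a => ⟨(τ a)ᵀ, by simp [hinv]⟩⟩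
        have : τ aᵀ = τ bᵀ := hab
        have := congrArg τ this
        rw [hinv, hinv] at this
        exact transpose_injective this)
  obtain ⟨P, Q, hPQ, hQP, hα⟩ := algEquiv_eq_conj α
  have hτ : ∀ a, τ a = P * aᵀ * Q := fun a => by
    rw [← hα]
    change τ a = τ aᵀᵀ
    rw [transpose_transpose]
  have hQPt : Qᵀ * Pᵀ = 1 := by rw [← transpose_mul, hPQ, transpose_one]
  -- `τ (τ a) = a` says that `P Qᵀ` is central; so `Pᵀ` is a multiple of `P`, and `P = ± Pᵀ`.
  obtain ⟨c, hc⟩ := exists_smul_one_of_commute (P * Qᵀ) (fun a => by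
    have := hinv a
    rw [hτ, hτ] at this
    simp only [transpose_mul, transpose_transpose] at this
    conv_rhs => rw [← this]
    calc P * Qᵀ * a = P * Qᵀ * a * (Pᵀ * (Q * P) * Qᵀ) := by
          rw [hQP, mul_one, ← transpose_mul, hQP, transpose_one, mul_one]
      _ = _ := by simp only [Matrix.mul_assoc])
  have hPt : P = c • Pᵀ := by
    calc P = (P * Qᵀ) * Pᵀ := by rw [Matrix.mul_assoc, hQPt, mul_one]
      _ = _ := by rw [hc, smul_mul_assoc, one_mul]
  have hcc : P = (c * c) • P := by
    have := congrArg transpose hPt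
    rw [transpose_smul, transpose_transpose] at this
    rw [← smul_smul, ← this]
    exact hPt
  have hc1 : P = Pᵀ ∨ P = -Pᵀ := by
    have h0 : ((c - 1) * (c + 1)) • P = 0 := by
      have : ((c - 1) * (c + 1)) = c * c - 1 := by ring
      rw [this, sub_smul, one_smul, ← hcc, sub_self]
    rcases smul_eq_zero.1 h0 with h | h
    · rcases mul_eq_zero.1 h with h | h
      · left
        rw [sub_eq_zero.1 h, one_smul] at hPt
        exact hPt
      · right
        rw [eq_neg_of_add_eq_zero_left h, neg_one_smul] at hPt
        exact hPt
    · left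
      simp [h]
  rcases hc1 with hP | hP
  · left
    obtain ⟨h, hh⟩ := exists_mul_transpose_eq h2 P hP.symm
    have hk : h * (hᵀ * Q) = 1 := by rw [← Matrix.mul_assoc, hh, hPQ]
    have hk' : (hᵀ * Q) * h = 1 := mul_eq_one_comm.1 hk
    have hQt : Qᵀ = Q := by
      calc Qᵀ = Qᵀ * (Pᵀ * Q) := by rw [← hP, hPQ, mul_one]
        _ = Q := by rw [← Matrix.mul_assoc, hQPt, one_mul]
    refine ⟨h, hᵀ * Q, hk, hk', fun a => ?_⟩
    rw [hτ]
    simp only [transpose_mul, transpose_transpose, hQt, Matrix.mul_assoc]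
    rw [← Matrix.mul_assoc Q P, hQP, one_mul]
  · right
    refine ⟨P, Q, hPQ, hQP, ?_, hτ⟩
    calc Qᵀ = Qᵀ * (P * Q) := by rw [hPQ, mul_one]
      _ = Qᵀ * (-Pᵀ * Q) := by rw [← hP]
      _ = -Q := by rw [neg_mul, mul_neg, ← Matrix.mul_assoc, hQPt, one_mul]

end MatrixInvolutions

/-! ### Subspaces stable under the skew elements -/

section Assembly

variable {E B : Type*} [Field E] [Ring B] [Algebra E B]

/-- The subspace of `τ`-symmetric elements. -/
def symmPart (τ : B →ₗ[E] B) : Submodule E B := LinearMap.eqLocus τ LinearMap.id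

/-- The subspace of `τ`-skew elements. -/
def skewPart (τ : B →ₗ[E] B) : Submodule E B := LinearMap.eqLocus τ (-LinearMap.id)

/-- A subspace stable under commutators with `τ`-skew elements. -/
def IsSkewStable (τ : B →ₗ[E] B) (W : Submodule E B) : Prop :=
  ∀ x ∈ W, ∀ k ∈ skewPart τ, x * k - k * x ∈ W

theorem mem_symmPart {τ : B →ₗ[E] B} {a : B} : a ∈ symmPart τ ↔ τ a = a := Iff.rfl

theorem mem_skewPart {τ : B →ₗ[E] B} {a : B} : a ∈ skewPart τ ↔ τ a = -a := Iff.rfl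

theorem commutator_mem_commSpan {U V : Set B} {u v : B} (hu : u ∈ U) (hv : v ∈ V) :
    u * v - v * u ∈ commSpan E U V :=
  Submodule.subset_span ⟨u, hu, v, hv, rfl⟩

theorem commSpan_mono {U U' V V' : Set B} (hU : U ⊆ U') (hV : V ⊆ V') :
    commSpan E U V ≤ commSpan E U' V' := by
  refine Submodule.span_mono ?_
  rintro x ⟨u, hu, v, hv, rfl⟩
  exact ⟨u, hU hu, v, hV hv, rfl⟩

theorem exists_symm_add_skew (h2 : (2 : E) ≠ 0) {τ : B →ₗ[E] B} (hinv : ∀ a, τ (τ a) = a)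
    (u : B) : ∃ s ∈ symmPart τ, ∃ k ∈ skewPart τ, u = s + k := by
  refine ⟨(2 : E)⁻¹ • (u + τ u), ?_, (2 : E)⁻¹ • (u - τ u), ?_, ?_⟩
  · rw [mem_symmPart, map_smul, map_add, hinv, add_comm]
  · rw [mem_skewPart, map_smul, map_sub, hinv, ← smul_neg, neg_sub]
  · rw [← smul_add, add_add_sub_cancel, ← two_smul E u, smul_smul, inv_mul_cancel₀ h2, one_smul]

theorem eq_zero_of_mem_symmPart_of_mem_skewPart (h2 : (2 : E) ≠ 0) {τ : B →ₗ[E] B} {a : B}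
    (hs : a ∈ symmPart τ) (hk : a ∈ skewPart τ) : a = 0 := by
  rw [mem_symmPart] at hs
  rw [mem_skewPart, hs, eq_neg_iff_add_eq_zero, ← two_smul E a] at hk
  exact (smul_eq_zero.1 hk).resolve_left h2

theorem commutator_symm_skew {τ : B →ₗ[E] B} (hmul : ∀ a b, τ (a * b) = τ b * τ a) {s k : B}
    (hs : s ∈ symmPart τ) (hk : k ∈ skewPart τ) : s * k - k * s ∈ symmPart τ := by
  rw [mem_symmPart, map_sub, hmul, hmul, mem_symmPart.1 hs, mem_skewPart.1 hk]
  noncomm_ring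

theorem commutator_skew_skew {τ : B →ₗ[E] B} (hmul : ∀ a b, τ (a * b) = τ b * τ a) {s k : B}
    (hs : s ∈ skewPart τ) (hk : k ∈ skewPart τ) : s * k - k * s ∈ skewPart τ := by
  rw [mem_skewPart, map_sub, hmul, hmul, mem_skewPart.1 hs, mem_skewPart.1 hk]
  noncomm_ring

theorem commutator_symm_symm {τ : B →ₗ[E] B} (hmul : ∀ a b, τ (a * b) = τ b * τ a) {s k : B}
    (hs : s ∈ symmPart τ) (hk : k ∈ symmPart τ) : s * k - k * s ∈ skewPart τ := by
  rw [mem_skewPart, map_sub, hmul, hmul, mem_symmPart.1 hs, mem_symmPart.1 hk]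
  noncomm_ring

theorem commSpan_symm_skew_le {τ : B →ₗ[E] B} (hmul : ∀ a b, τ (a * b) = τ b * τ a) :
    commSpan E (symmPart τ : Set B) (skewPart τ : Set B) ≤ symmPart τ := by
  refine Submodule.span_le.2 ?_
  rintro x ⟨s, hs, k, hk, rfl⟩
  exact commutator_symm_skew hmul hs hk

theorem isSkewStable_commSpan_symm_skew {τ : B →ₗ[E] B} (hmul : ∀ a b, τ (a * b) = τ b * τ a) :
    IsSkewStable τ (commSpan E (symmPart τ : Set B) (skewPart τ : Set B)) := fun _ hx _ hk =>
  commutator_mem_commSpan (commSpan_symm_skew_le hmul hx) hk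

/-- If `N ≤ W ≤ M` and `M` exceeds `N` by at most one dimension, then `W` is `N` or `M`. -/
theorem eq_or_eq_of_le_sup_span {N W M : Submodule E B} {s : B} (hN : N ≤ W) (hM : W ≤ M)
    (hs : M ≤ N ⊔ Submodule.span E {s}) : W = N ∨ W = M := by
  rw [or_iff_not_imp_left]
  intro hne
  obtain ⟨w, hw, hwN⟩ : ∃ w ∈ W, w ∉ N := by
    by_contra! h
    exact hne (le_antisymm h hN)
  obtain ⟨a, ha, b, hb, rfl⟩ := Submodule.mem_sup.1 (hs (hM hw))
  obtain ⟨c, rfl⟩ := Submodule.mem_span_singleton.1 hb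
  have hc : c ≠ 0 := by
    rintro rfl
    exact hwN (by simpa using ha)
  have hsW : s ∈ W := by
    have h1 : c • s ∈ W := (Submodule.add_mem_iff_right W (hN ha)).1 hw
    simpa [smul_smul, inv_mul_cancel₀ hc] using W.smul_mem c⁻¹ h1
  refine le_antisymm hM (hs.trans (sup_le hN ?_))
  simpa using hsW

/-- What has to be known about the action of the `τ`-skew elements on `B` in order to classify all
subspaces stable under it. With `S` and `K` the symmetric and skew elements: a stable subspace not
in `S` contains `K`, a non-scalar stable subspace of `S` contains `[S, K]`, the codimension of
`[S, K]` in `S` is at most one, and `K` is not commutative. -/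
structure HasSkewStableDichotomy (τ : B →ₗ[E] B) : Prop where
  skew_le : ∀ W, IsSkewStable τ W → ¬ W ≤ symmPart τ → skewPart τ ≤ W
  comm_le : ∀ W, IsSkewStable τ W → W ≤ symmPart τ → ¬ W ≤ Submodule.span E {1} →
    commSpan E (symmPart τ : Set B) (skewPart τ : Set B) ≤ W
  symm_le : ∃ s, symmPart τ ≤
    commSpan E (symmPart τ : Set B) (skewPart τ : Set B) ⊔ Submodule.span E {s}
  not_comm : ∃ k ∈ skewPart τ, ∃ l ∈ skewPart τ, k * l - l * k ≠ 0

theorem HasSkewStableDichotomy.classification_le_symm {τ : B →ₗ[E] B}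
    (hτ : HasSkewStableDichotomy τ)
    {W : Submodule E B} (hW : IsSkewStable τ W) (hWS : W ≤ symmPart τ) :
    W = ⊥ ∨ W = Submodule.span E {1} ∨
      W = commSpan E (symmPart τ : Set B) (skewPart τ : Set B) ∨ W = symmPart τ := by
  by_cases h : W ≤ Submodule.span E {1}
  · rcases eq_or_eq_of_le_sup_span bot_le h (bot_sup_eq _).ge with h | h <;> simp [h]
  · obtain ⟨s, hs⟩ := hτ.symm_le
    rcases eq_or_eq_of_le_sup_span (hτ.comm_le W hW hWS h) hWS hs with h | h <;> simp [h]

/-- Since `K ⊆ W` unless `W ⊆ S`, a stable subspace not contained in `S` is `K` plus one of the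
stable subspaces of `S`. -/
theorem HasSkewStableDichotomy.classification (h2 : (2 : E) ≠ 0) {τ : B →ₗ[E] B}
    (hmul : ∀ a b, τ (a * b) = τ b * τ a) (hinv : ∀ a, τ (τ a) = a)
    (hτ : HasSkewStableDichotomy τ) {W : Submodule E B} (hW : IsSkewStable τ W) :
    W = ⊥ ∨ W = Submodule.span E {1} ∨ W = skewPart τ ∨
      W = commSpan E (symmPart τ : Set B) (skewPart τ : Set B) ∨ W = symmPart τ ∨
      W = Submodule.span E {1} ⊔ skewPart τ ∨ W = commSpan E Set.univ Set.univ ∨ W = ⊤ := by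
  by_cases hWS : W ≤ symmPart τ
  · rcases hτ.classification_le_symm hW hWS with h | h | h | h <;> simp [h]
  have hKW := hτ.skew_le W hW hWS
  have hdec : W = (W ⊓ symmPart τ) ⊔ skewPart τ := by
    refine le_antisymm (fun w hw => ?_) (sup_le inf_le_left hKW)
    obtain ⟨s, hs, k, hk, rfl⟩ := exists_symm_add_skew h2 hinv w
    exact Submodule.add_mem_sup ⟨(Submodule.add_mem_iff_left W (hKW hk)).1 hw, hs⟩ hk
  have hstable : IsSkewStable τ (W ⊓ symmPart τ) := fun x hx k hk =>
    ⟨hW x hx.1 k hk, commutator_symm_skew hmul hx.2 hk⟩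
  have htop : symmPart τ ⊔ skewPart τ = ⊤ := by
    rw [eq_top_iff]
    intro u _
    obtain ⟨s, hs, k, hk, rfl⟩ := exists_symm_add_skew h2 hinv u
    exact Submodule.add_mem_sup hs hk
  have hcomm : commSpan E (symmPart τ : Set B) (skewPart τ : Set B) ⊔ skewPart τ =
      commSpan E Set.univ Set.univ := by
    refine le_antisymm (sup_le (commSpan_mono (Set.subset_univ _) (Set.subset_univ _)) ?_)
      (Submodule.span_le.2 ?_)
    · refine hτ.skew_le _ (fun x _ k _ => commutator_mem_commSpan trivial trivial) fun h => ?_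
      obtain ⟨k, hk, l, hl, hne⟩ := hτ.not_comm
      exact hne (eq_zero_of_mem_symmPart_of_mem_skewPart h2
        (h (commutator_mem_commSpan trivial trivial)) (commutator_skew_skew hmul hk hl))
    · rintro x ⟨u, -, v, -, rfl⟩
      obtain ⟨s, hs, k, hk, rfl⟩ := exists_symm_add_skew h2 hinv u
      obtain ⟨s', hs', k', hk', rfl⟩ := exists_symm_add_skew h2 hinv v
      have : (s + k) * (s' + k') - (s' + k') * (s + k) =
          ((s * k' - k' * s) - (s' * k - k * s')) +
            ((s * s' - s' * s) + (k * k' - k' * k)) := by noncomm_ring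
      rw [this]
      exact Submodule.add_mem_sup
        (Submodule.sub_mem _ (commutator_mem_commSpan hs hk') (commutator_mem_commSpan hs' hk))
        (Submodule.add_mem _ (commutator_symm_symm hmul hs hs') (commutator_skew_skew hmul hk hk'))
  rw [hdec]
  rcases hτ.classification_le_symm hstable inf_le_right with h | h | h | h <;> rw [h]
  · simp
  · simp
  · simp [hcomm]
  · simp [htop]

end Assembly

/-! ### The transpose involution -/

section Transpose

open Matrix

variable {E : Type*} [Field E] {n : ℕ}

/-- Matrix transposition as a linear map. -/
def transposeLin (E : Type*) [Field E] (n : ℕ) :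
    Matrix (Fin n) (Fin n) E →ₗ[E] Matrix (Fin n) (Fin n) E :=
  (transposeLinearEquiv (Fin n) (Fin n) E E).toLinearMap

theorem mem_symmPart_transposeLin {a : Matrix (Fin n) (Fin n) E} :
    a ∈ symmPart (transposeLin E n) ↔ aᵀ = a := Iff.rfl

theorem mem_skewPart_transposeLin {a : Matrix (Fin n) (Fin n) E} :
    a ∈ skewPart (transposeLin E n) ↔ aᵀ = -a := Iff.rfl

/-- The elementary skew-symmetric matrix `E_ij - E_ji`. -/
def skewSingle (E : Type*) [Field E] {n : ℕ} (i j : Fin n) : Matrix (Fin n) (Fin n) E :=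
  single i j 1 - single j i 1

/-- The elementary symmetric matrix `E_ij + E_ji`; for `i = j` this is `2 E_ii`. -/
def symmSingle (E : Type*) [Field E] {n : ℕ} (i j : Fin n) : Matrix (Fin n) (Fin n) E :=
  single i j 1 + single j i 1

theorem skewSingle_mem (i j : Fin n) : skewSingle E i j ∈ skewPart (transposeLin E n) := by
  rw [mem_skewPart_transposeLin, skewSingle]
  simp

theorem symmSingle_mem (i j : Fin n) : symmSingle E i j ∈ symmPart (transposeLin E n) := by
  rw [mem_symmPart_transposeLin, symmSingle]
  simp [add_comm]

theorem skewSingle_swap (i j : Fin n) : skewSingle E j i = - skewSingle E i j := by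
  simp [skewSingle]

theorem symmSingle_swap (i j : Fin n) : symmSingle E j i = symmSingle E i j := by
  simp [symmSingle, add_comm]

theorem single_eq_smul_one (i j : Fin n) (x : E) : single i j x = x • single i j (1 : E) := by
  simp

theorem skewSingle_mul_self {i j : Fin n} (hij : i ≠ j) :
    skewSingle E i j * skewSingle E i j = -(single i i 1 + single j j 1) := by
  simp [skewSingle, mul_sub, sub_mul, hij, hij.symm]
  abel

theorem skewSingle_mul_mul {i j : Fin n} (a : Matrix (Fin n) (Fin n) E) :
    skewSingle E i j * a * skewSingle E i j =
      a j i • single i j 1 - a j j • single i i 1 - a i i • single j j 1 +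
        a i j • single j i 1 := by
  simp only [skewSingle, mul_sub, sub_mul, single_mul_mul_single, one_mul, mul_one]
  rw [single_eq_smul_one i j, single_eq_smul_one i i, single_eq_smul_one j j,
    single_eq_smul_one j i]
  module

/-- For `e = E_ij - E_ji` the operator `(ad e)⁴ + (ad e)²` is `12` times a projection of the `2 × 2`
block of rows and columns `i`, `j` onto the trace zero symmetric matrices. The element below is
twice the projection of `a`. -/
theorem IsSkewStable.block_mem (h6 : (6 : E) ≠ 0) {W : Submodule E (Matrix (Fin n) (Fin n) E)}
    (hW : IsSkewStable (transposeLin E n) W) {i j : Fin n} (hij : i ≠ j)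
    {a : Matrix (Fin n) (Fin n) E} (ha : a ∈ W) :
    (a i i - a j j) • (single i i 1 - single j j 1) + (a i j + a j i) • symmSingle E i j ∈ W := by
  set e := skewSingle E i j with he
  have hee : e * e = -(single i i 1 + single j j 1) := skewSingle_mul_self hij
  -- The identity below expands `(ad e)⁴ + (ad e)²` so that all terms but two contain `e³ + e`.
  have heee : e * e * e + e = 0 := by
    rw [hee, he]
    simp [skewSingle, mul_sub, add_mul, hij, hij.symm]
  have step : ∀ x ∈ W, x * e - e * x ∈ W := fun x hx => hW x hx e (skewSingle_mem i j)
  have h2 := step _ (step _ ha)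
  have h4 := step _ (step _ h2)
  have hsum := W.add_mem h4 h2
  set x := a * e - e * a
  have key : (((x * e - e * x) * e - e * (x * e - e * x)) * e -
      e * ((x * e - e * x) * e - e * (x * e - e * x))) + (x * e - e * x) =
      (6 : E) • (e * e * a * (e * e) + e * a * e) := by
    have : (((x * e - e * x) * e - e * (x * e - e * x)) * e -
      e * ((x * e - e * x) * e - e * (x * e - e * x))) + (x * e - e * x) =
      a * ((e * e * e + e) * e) - (4 : ℕ) • (e * a * (e * e * e + e))
       - (4 : ℕ) • ((e * e * e + e) * a * e) + (e * e * e + e) * e * a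
        + (6 : ℕ) • (e * e * a * (e * e) + e * a * e) := by
      simp only [x]
      noncomm_ring
    rw [this, heee]
    simp [← Nat.cast_smul_eq_nsmul E]
  rw [key] at hsum
  have := W.smul_mem (6 : E)⁻¹ hsum
  rw [smul_smul, inv_mul_cancel₀ h6, one_smul, hee, he, skewSingle_mul_mul] at this
  convert this using 1
  simp only [symmSingle, neg_mul, mul_neg, add_mul, mul_add, single_mul_mul_single,
    one_mul, mul_one]
  rw [single_eq_smul_one i j (a i j), single_eq_smul_one i i (a i i),
    single_eq_smul_one j j (a j j), single_eq_smul_one j i (a j i)]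
  module

theorem symmSingle_commutator {i j k : Fin n} (hij : i ≠ j) (hik : i ≠ k) (hjk : j ≠ k) :
    symmSingle E i j * skewSingle E i k - skewSingle E i k * symmSingle E i j =
      symmSingle E j k := by
  simp [symmSingle, skewSingle, mul_sub, sub_mul, mul_add, add_mul, hij, hij.symm, hik, hik.symm,
    hjk, hjk.symm]

theorem diagSingle_commutator {i j k : Fin n} (hij : i ≠ j) (hik : i ≠ k) (hjk : j ≠ k) :
    (single i i 1 - single j j 1) * skewSingle E i k -
      skewSingle E i k * (single i i 1 - single j j 1) = symmSingle E i k := by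
  simp [symmSingle, skewSingle, mul_sub, sub_mul, hij, hij.symm, hik, hik.symm,
    hjk, hjk.symm]

theorem symmSingle_commutator_self {i j : Fin n} (hij : i ≠ j) :
    symmSingle E i j * skewSingle E i j - skewSingle E i j * symmSingle E i j =
      (-2 : E) • (single i i 1 - single j j 1) := by
  simp [symmSingle, skewSingle, mul_sub, sub_mul, mul_add, add_mul, hij, hij.symm]
  module

theorem skewSingle_commutator {i j k : Fin n} (hij : i ≠ j) (hik : i ≠ k) (hjk : j ≠ k) :
    skewSingle E i j * skewSingle E j k - skewSingle E j k * skewSingle E i j =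
      skewSingle E i k := by
  simp [skewSingle, mul_sub, sub_mul, hij, hij.symm, hik, hik.symm, hjk, hjk.symm]

theorem exists_ne_ne (hn : 3 ≤ n) (i j : Fin n) : ∃ k, i ≠ k ∧ j ≠ k := by
  obtain ⟨k, hk⟩ := Finset.exists_mem_notMem_of_card_lt_card (s := {i, j}) (t := Finset.univ)
    (lt_of_le_of_lt Finset.card_le_two (by rw [Finset.card_univ, Fintype.card_fin]; omega))
  simp at hk
  exact ⟨k, fun h => hk.1 h.symm, fun h => hk.2 h.symm⟩

/-- A skew-stable subspace whose elements are not all of the form "scalar plus skew" contains every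
`E_kl + E_lk`. -/
theorem IsSkewStable.symmSingle_mem_of_ne (h2 : (2 : E) ≠ 0) (h6 : (6 : E) ≠ 0) (hn : 3 ≤ n)
    {W : Submodule E (Matrix (Fin n) (Fin n) E)}
    (hW : IsSkewStable (transposeLin E n) W) {i j : Fin n} (hij : i ≠ j)
    {a : Matrix (Fin n) (Fin n) E} (ha : a ∈ W) (hne : a i i - a j j ≠ 0 ∨ a i j + a j i ≠ 0) :
    ∀ k l, k ≠ l → symmSingle E k l ∈ W := by
  obtain ⟨t, hit, hjt⟩ := exists_ne_ne hn i j
  set α := a i i - a j j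
  set β := a i j + a j i
  -- A commutator with `E_it - E_ti` moves the two coordinates of the projected block to the
  -- different blocks `{i, t}` and `{j, t}`, where they can be separated by another projection.
  have hm : α • symmSingle E i t + β • symmSingle E j t ∈ W := by
    have := hW _ (hW.block_mem h6 hij ha) _ (skewSingle_mem i t)
    rw [← diagSingle_commutator hij hit hjt, ← symmSingle_commutator hij hit hjt]
    convert this using 1
    simp only [add_mul, mul_add, smul_mul_assoc, mul_smul_comm]
    module
  have h2' : ∀ {c : E} {x : Matrix (Fin n) (Fin n) E}, c ≠ 0 → (c * 2) • x ∈ W → x ∈ W := by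
    intro c x hc hx
    have := W.smul_mem (c * 2)⁻¹ hx
    rwa [smul_smul, inv_mul_cancel₀ (mul_ne_zero hc h2), one_smul] at this
  have hstart : ∃ p q : Fin n, p ≠ q ∧ symmSingle E p q ∈ W := by
    rcases hne with h | h
    · refine ⟨i, t, hit, h2' h ?_⟩
      have := hW.block_mem h6 hit hm
      simpa [symmSingle, single_apply, hij, hij.symm, hit, hit.symm, hjt, hjt.symm,
        mul_two] using this
    · refine ⟨j, t, hjt, h2' h ?_⟩
      have := hW.block_mem h6 hjt hm
      simpa [symmSingle, single_apply, hij, hij.symm, hit, hit.symm, hjt, hjt.symm,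
        mul_two] using this
  have row : ∀ {p q r : Fin n}, p ≠ q → r ≠ p → symmSingle E p q ∈ W → symmSingle E p r ∈ W := by
    intro p q r hpq hrp h
    by_cases hqr : q = r
    · rwa [← hqr]
    rw [← symmSingle_commutator (E := E) hpq.symm hqr hrp.symm, symmSingle_swap]
    exact hW _ h _ (skewSingle_mem q r)
  obtain ⟨p, q, hpq, h⟩ := hstart
  intro k l hkl
  by_cases hkp : k = p
  · subst hkp
    exact row hpq hkl.symm h
  · have h1 := row hpq hkp h
    rw [symmSingle_swap] at h1
    exact row hkp hkl.symm h1

/-- The matrices `E_kl + E_lk`, `k ≠ l`, generate all symmetric matrices of trace zero. -/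
theorem IsSkewStable.mem_of_symm_of_trace (h2 : (2 : E) ≠ 0)
    {W : Submodule E (Matrix (Fin n) (Fin n) E)}
    (hW : IsSkewStable (transposeLin E n) W) (h : ∀ k l, k ≠ l → symmSingle E k l ∈ W)
    {m : Matrix (Fin n) (Fin n) E} (hm : mᵀ = m) (htr : m.trace = 0) : m ∈ W := by
  have hdiag : ∀ k l, single k k (1 : E) - single l l 1 ∈ W := by
    intro k l
    by_cases hkl : k = l
    · simp [hkl]
    have := hW _ (h k l hkl) _ (skewSingle_mem k l)
    rw [symmSingle_commutator_self hkl] at this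
    have := W.smul_mem (-2 : E)⁻¹ this
    rwa [smul_smul, inv_mul_cancel₀ (neg_ne_zero.2 h2), one_smul] at this
  rcases Nat.eq_zero_or_pos n with hn | hn
  · subst hn
    rw [Subsingleton.elim m 0]
    exact W.zero_mem
  let o : Fin n := ⟨0, hn⟩
  have hexp : (2 : E) • m = ∑ k, ∑ l, m k l •
      (if k = l then (2 : E) • (single k k (1 : E) - single o o 1)
      else symmSingle E k l) := by
    have h1 : ∑ k, ∑ l, m k l • single k l (1 : E) = m := by
      conv_rhs => rw [matrix_eq_sum_single m]
      simp
    have h3 : ∑ k, ∑ l, m k l • single l k (1 : E) = m := by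
      rw [Finset.sum_comm]
      conv_rhs => rw [← h1]
      refine Finset.sum_congr rfl fun k _ => Finset.sum_congr rfl fun l _ => ?_
      conv_lhs => rw [← hm, transpose_apply]
    have h4 : ∑ k, ∑ l, m k l • (if k = l then (2 : E) • single o o (1 : E) else 0) = 0 := by
      simp only [smul_ite, smul_zero, Finset.sum_ite_eq, Finset.mem_univ, if_true]
      rw [← Finset.sum_smul]
      have : ∑ k, m k k = 0 := htr
      rw [this, zero_smul]
    rw [two_smul]
    conv_lhs => rw [← sub_zero (m + m), ← h4]
    nth_rw 1 [← h1]
    nth_rw 2 [← h3]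
    rw [← Finset.sum_add_distrib, ← Finset.sum_sub_distrib]
    refine Finset.sum_congr rfl fun k _ => ?_
    rw [← Finset.sum_add_distrib, ← Finset.sum_sub_distrib]
    refine Finset.sum_congr rfl fun l _ => ?_
    split_ifs with hkl
    · subst hkl
      module
    · rw [symmSingle]
      module
  have : (2 : E) • m ∈ W := by
    rw [hexp]
    refine Submodule.sum_mem _ fun k _ => Submodule.sum_mem _ fun l _ => Submodule.smul_mem _ _ ?_
    split_ifs with hkl
    · exact W.smul_mem _ (hdiag _ _)
    · exact h k l hkl
  have := W.smul_mem (2 : E)⁻¹ this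
  rwa [smul_smul, inv_mul_cancel₀ h2, one_smul] at this

/-- The matrix obtained from `k` by keeping only the entries with exactly one index in `{i, j}`. -/
def mask (i j : Fin n) (k : Matrix (Fin n) (Fin n) E) : Matrix (Fin n) (Fin n) E :=
  Matrix.of fun r c => if (r = i ∨ r = j) ↔ (c = i ∨ c = j) then 0 else k r c

/-- On skew matrices, the mask is the operator `-(ad (E_ij - E_ji))²`. -/
theorem mask_eq (h2 : (2 : E) ≠ 0) {i j : Fin n} (hij : i ≠ j) {k : Matrix (Fin n) (Fin n) E}
    (hk : k ∈ skewPart (transposeLin E n)) :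
    mask i j k = -((k * skewSingle E i j - skewSingle E i j * k) * skewSingle E i j -
      skewSingle E i j * (k * skewSingle E i j - skewSingle E i j * k)) := by
  have hk' : ∀ r c, k c r = - k r c := fun r c => congr_fun (congr_fun hk r) c
  have hd : ∀ r, k r r = 0 := fun r => by
    have := hk' r r
    rw [eq_neg_iff_add_eq_zero, ← two_mul] at this
    exact (mul_eq_zero.1 this).resolve_left h2
  have : (k * skewSingle E i j - skewSingle E i j * k) * skewSingle E i j -
      skewSingle E i j * (k * skewSingle E i j - skewSingle E i j * k) =
      k * (skewSingle E i j * skewSingle E i j) + (skewSingle E i j * skewSingle E i j) * k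
      - (2 : ℕ) • (skewSingle E i j * k * skewSingle E i j) := by noncomm_ring
  rw [this, skewSingle_mul_self hij, skewSingle_mul_mul, hd i, hd j, hk' i j]
  have hr : ∀ p r c, (k * single p p (1 : E)) r c = if c = p then k r c else 0 := by
    intro p r c
    split_ifs with h
    · subst h; simp
    · exact Matrix.mul_single_apply_of_ne _ _ _ _ _ h _
  have hl : ∀ p r c, (single p p (1 : E) * k) r c = if r = p then k r c else 0 := by
    intro p r c
    split_ifs with h
    · subst h; simp
    · exact Matrix.single_mul_apply_of_ne _ _ _ _ _ h _
  ext r c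
  simp only [mask, of_apply, mul_neg, neg_mul, mul_add, add_mul, Matrix.neg_apply, Matrix.sub_apply,
    Matrix.add_apply, Matrix.smul_apply, hr, hl, single_apply, smul_eq_mul, zero_mul, two_nsmul]
  have := hk' i j
  have hdi := hd i
  have hdj := hd j
  have hij' := hij.symm
  by_cases h1 : r = i
  · subst h1
    by_cases h3 : c = r
    · subst h3; simp [hij, hd]
    · by_cases h4 : c = j
      · subst h4; simp [hij, hij']
      · simp [h3, h4, hij, Ne.symm h3, Ne.symm h4]
  · by_cases h2 : r = j
    · subst h2
      by_cases h3 : c = i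
      · subst h3; simp [hij, hij', this]
      · by_cases h4 : c = r
        · subst h4; simp [hij, hd]
        · simp [h3, h4, hij, Ne.symm h3, Ne.symm h4, hij']
    · simp [h1, h2, Ne.symm h1, Ne.symm h2]
      by_cases h3 : c = i
      · subst h3; simp [hij]
      · by_cases h4 : c = j <;> simp [h3, h4, hij']

theorem mask_mem_skewPart {i j : Fin n} {k : Matrix (Fin n) (Fin n) E}
    (hk : k ∈ skewPart (transposeLin E n)) : mask i j k ∈ skewPart (transposeLin E n) := by
  have hk' : ∀ r c, k c r = - k r c := fun r c => congr_fun (congr_fun hk r) c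
  rw [mem_skewPart_transposeLin]
  ext r c
  simp only [mask, transpose_apply, of_apply, Matrix.neg_apply, hk' r c]
  by_cases h : (r = i ∨ r = j) ↔ (c = i ∨ c = j)
  · simp [h]
  · rw [if_neg h, if_neg (fun h' => h h'.symm)]

/-- For `n = 3` two masks isolate one entry. -/
theorem mask_comp_three {p q t : Fin n} (hn : n = 3) (hpq : p ≠ q) (hpt : p ≠ t) (hqt : q ≠ t)
    {k : Matrix (Fin n) (Fin n) E} (hk : k ∈ skewPart (transposeLin E n)) :
    mask q t (mask p t k) = k p q • skewSingle E p q := by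
  have hk' : ∀ r c, k c r = - k r c := fun r c => congr_fun (congr_fun hk r) c
  have hall : ∀ r : Fin n, r = p ∨ r = q ∨ r = t := by
    subst hn
    revert p q t
    clear hk
    decide +revert
  have hqp := hk' p q
  ext r c
  rcases hall r with rfl | rfl | rfl <;> rcases hall c with rfl | rfl | rfl <;>
    simp [mask, skewSingle, hpq, hpt, hqt, hpq.symm, hpt.symm, hqt.symm, hqp]

/-- If there are three indices besides `p` and `q`, four masks isolate one entry: the masks of
`{p, t}`, `{p, u}`, `{p, v}` leave only the rest of row and column `p`, and the mask of `{q, t}`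
then leaves only the index `q` there. With fewer than three indices the entry `(t, u)` would
survive the masks that involve `p`. -/
theorem mask_comp_five {p q t u v : Fin n} (hpq : p ≠ q) (hpt : p ≠ t) (hqt : q ≠ t)
    (hqu : q ≠ u) (htu : t ≠ u) (hpv : p ≠ v) (hqv : q ≠ v) (htv : t ≠ v)
    (huv : u ≠ v)
    {k : Matrix (Fin n) (Fin n) E} (hk : k ∈ skewPart (transposeLin E n)) :
    mask q t (mask p v (mask p u (mask p t k))) = k p q • skewSingle E p q := by
  have hk' : k q p = - k p q := congr_fun (congr_fun hk p) q
  ext r c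
  simp only [mask, of_apply, skewSingle, Matrix.smul_apply, Matrix.sub_apply, single_apply,
    smul_eq_mul]
  grind (splits := 30)

theorem skewPart_le_of_skewSingle_mem (h2 : (2 : E) ≠ 0)
    {W : Submodule E (Matrix (Fin n) (Fin n) E)} (h : ∀ k l, skewSingle E k l ∈ W) :
    skewPart (transposeLin E n) ≤ W := by
  intro m hm
  have hexp : (2 : E) • m = ∑ k, ∑ l, m k l • skewSingle E k l := by
    have h1 : ∑ k, ∑ l, m k l • single k l (1 : E) = m := by
      conv_rhs => rw [matrix_eq_sum_single m]
      simp
    have h3 : ∑ k, ∑ l, m k l • single l k (1 : E) = -m := by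
      rw [Finset.sum_comm]
      conv_rhs => rw [← h1]
      simp only [← Finset.sum_neg_distrib]
      refine Finset.sum_congr rfl fun k _ => Finset.sum_congr rfl fun l _ => ?_
      have : m l k = - m k l := congr_fun (congr_fun hm k) l
      rw [this, neg_smul]
    calc (2 : E) • m = m - -m := by rw [two_smul, sub_neg_eq_add]
      _ = ∑ k, ∑ l, m k l • single k l (1 : E) - ∑ k, ∑ l, m k l • single l k (1 : E) := by
        rw [h1, h3]
      _ = _ := by simp only [← Finset.sum_sub_distrib, ← smul_sub, skewSingle]
  have : (2 : E) • m ∈ W := by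
    rw [hexp]
    exact Submodule.sum_mem _ fun k _ => Submodule.sum_mem _ fun l _ =>
      Submodule.smul_mem _ _ (h k l)
  have := W.smul_mem (2 : E)⁻¹ this
  rwa [smul_smul, inv_mul_cancel₀ h2, one_smul] at this

theorem IsSkewStable.mask_mem (h2 : (2 : E) ≠ 0) {W : Submodule E (Matrix (Fin n) (Fin n) E)}
    (hW : IsSkewStable (transposeLin E n) W) {i j : Fin n} (hij : i ≠ j)
    {k : Matrix (Fin n) (Fin n) E} (hk : k ∈ skewPart (transposeLin E n))
    (hkW : ∀ l ∈ skewPart (transposeLin E n), k * l - l * k ∈ W) : mask i j k ∈ W := by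
  rw [mask_eq h2 hij hk]
  exact W.neg_mem (hW _ (hkW _ (skewSingle_mem i j)) _ (skewSingle_mem i j))

/-- The Lie algebra of skew-symmetric matrices is simple for `n = 3` and `n ≥ 5`. The matrix `k`
need not lie in `W`; it is enough that its commutators with skew matrices do. -/
theorem IsSkewStable.skewPart_le_of_skew (h2 : (2 : E) ≠ 0) (hn : n = 3 ∨ 5 ≤ n)
    {W : Submodule E (Matrix (Fin n) (Fin n) E)}
    (hW : IsSkewStable (transposeLin E n) W) {k : Matrix (Fin n) (Fin n) E}
    (hk : k ∈ skewPart (transposeLin E n)) (hk0 : k ≠ 0)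
    (hkW : ∀ l ∈ skewPart (transposeLin E n), k * l - l * k ∈ W) :
    skewPart (transposeLin E n) ≤ W := by
  obtain ⟨p, q, hpq0⟩ : ∃ p q, k p q ≠ 0 := by
    by_contra! h
    exact hk0 (by ext p q; exact h p q)
  have hpq : p ≠ q := by
    rintro rfl
    have : k p p = - k p p := congr_fun (congr_fun hk p) p
    rw [eq_neg_iff_add_eq_zero, ← two_mul] at this
    exact hpq0 ((mul_eq_zero.1 this).resolve_left h2)
  have hstart : k p q • skewSingle E p q ∈ W := by
    obtain ⟨t, hpt, hqt⟩ := exists_ne_ne (by omega) p q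
    rcases hn with hn | hn
    · rw [← mask_comp_three hn hpq hpt hqt hk]
      have h1 := hW.mask_mem h2 hpt hk hkW
      exact hW.mask_mem h2 hqt (mask_mem_skewPart hk) (hW _ h1)
    · obtain ⟨u, hu⟩ := Finset.exists_mem_notMem_of_card_lt_card (s := {p, q, t}) (t := Finset.univ)
        (lt_of_le_of_lt Finset.card_le_three (by rw [Finset.card_univ, Fintype.card_fin]; omega))
      obtain ⟨v, hv⟩ := Finset.exists_mem_notMem_of_card_lt_card (s := {p, q, t, u})
        (t := Finset.univ)
        (lt_of_le_of_lt Finset.card_le_four (by rw [Finset.card_univ, Fintype.card_fin]; omega))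
      simp only [Finset.mem_univ, Finset.mem_insert, Finset.mem_singleton, not_or,
        true_and] at hu hv
      obtain ⟨hup, huq, hut⟩ := hu
      obtain ⟨hvp, hvq, hvt, hvu⟩ := hv
      rw [← mask_comp_five hpq hpt hqt (Ne.symm huq) (Ne.symm hut) (Ne.symm hvp)
        (Ne.symm hvq) (Ne.symm hvt) (Ne.symm hvu) hk]
      have h1 := hW.mask_mem h2 hpt hk hkW
      have s1 := mask_mem_skewPart (i := p) (j := t) hk
      have h3 := hW.mask_mem h2 (Ne.symm hup) s1 (hW _ h1)
      have s3 := mask_mem_skewPart (i := p) (j := u) s1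
      have h4 := hW.mask_mem h2 (Ne.symm hvp) s3 (hW _ h3)
      exact hW.mask_mem h2 hqt (mask_mem_skewPart s3) (hW _ h4)
  have h := W.smul_mem (k p q)⁻¹ hstart
  rw [smul_smul, inv_mul_cancel₀ hpq0, one_smul] at h
  have row : ∀ {p q r : Fin n}, p ≠ q → r ≠ p → skewSingle E p q ∈ W → skewSingle E p r ∈ W := by
    intro p q r hpq hrp h
    by_cases hqr : q = r
    · rwa [← hqr]
    rw [← skewSingle_commutator (E := E) hpq hrp.symm hqr]
    exact hW _ h _ (skewSingle_mem q r)
  refine skewPart_le_of_skewSingle_mem h2 fun i j => ?_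
  by_cases hij : i = j
  · subst hij
    simp [skewSingle]
  by_cases hip : i = p
  · subst hip
    exact row hpq (Ne.symm hij) h
  · have h1 := row hpq hip h
    rw [← neg_mem_iff, ← skewSingle_swap] at h1
    exact row hip (Ne.symm hij) h1

theorem IsSkewStable.commutator_mem_of_symmSingle (h2 : (2 : E) ≠ 0)
    {W : Submodule E (Matrix (Fin n) (Fin n) E)}
    (hW : IsSkewStable (transposeLin E n) W) (h : ∀ k l, k ≠ l → symmSingle E k l ∈ W)
    {s l : Matrix (Fin n) (Fin n) E} (hs : s ∈ symmPart (transposeLin E n))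
    (hl : l ∈ skewPart (transposeLin E n)) : s * l - l * s ∈ W := by
  refine hW.mem_of_symm_of_trace h2 h ?_ ?_
  · exact commutator_symm_skew (fun a b => transpose_mul a b) hs hl
  · rw [trace_sub, trace_mul_comm, sub_self]

theorem eq_smul_one_of_forall_ne [NeZero n] {s : Matrix (Fin n) (Fin n) E}
    (h : ∀ i j, i ≠ j → s i j = 0 ∧ s i i = s j j) : s = s 0 0 • 1 := by
  ext i j
  by_cases hij : i = j
  · subst hij
    by_cases hi : i = 0
    · simp [hi]
    · simp [(h i 0 hi).2]
  · simp [hij, (h i j hij).1]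

/-- The dichotomy for the transpose. If `s + k ∈ W` with `s` symmetric and `k ≠ 0` skew, then either
`s` is scalar or `[S, K] ⊆ W`; in both cases `W` contains the commutators of `k` with `K`. -/
theorem hasSkewStableDichotomy_transposeLin (h2 : (2 : E) ≠ 0) (h3 : (3 : E) ≠ 0)
    (hn : n = 3 ∨ 5 ≤ n) : HasSkewStableDichotomy (transposeLin E n) := by
  have h6 : (6 : E) ≠ 0 := by
    have : (6 : E) = 2 * 3 := by norm_num
    rw [this]
    exact mul_ne_zero h2 h3
  have hn3 : 3 ≤ n := by omega
  have : NeZero n := ⟨by omega⟩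
  let x0 : Fin n := ⟨0, by omega⟩
  let x1 : Fin n := ⟨1, by omega⟩
  let x2 : Fin n := ⟨2, by omega⟩
  have h01 : x0 ≠ x1 := by simp [x0, x1]
  have h02 : x0 ≠ x2 := by simp [x0, x2]
  have h12 : x1 ≠ x2 := by simp [x1, x2]
  have hmul : ∀ a b, transposeLin E n (a * b) = transposeLin E n b * transposeLin E n a :=
    fun a b => transpose_mul a b
  refine ⟨fun W hW hWS => ?_, fun W hW hWS hWZ => ?_, ⟨single x0 x0 1, fun m hm => ?_⟩, ?_⟩
  · obtain ⟨a, ha, haS⟩ := Set.not_subset.1 hWS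
    obtain ⟨s, hs, k, hk, rfl⟩ := exists_symm_add_skew (τ := transposeLin E n) h2
      (fun a => transpose_transpose a) a
    have hk0 : k ≠ 0 := by
      rintro rfl
      exact haS (by simpa using hs)
    refine hW.skewPart_le_of_skew h2 hn hk hk0 fun l hl => ?_
    have hal := hW _ ha l hl
    have hsplit : (s + k) * l - l * (s + k) = (s * l - l * s) + (k * l - l * k) := by noncomm_ring
    rw [hsplit] at hal
    refine (Submodule.add_mem_iff_right W ?_).1 hal
    by_cases hex : ∃ i j, i ≠ j ∧ ((s + k) i i - (s + k) j j ≠ 0 ∨ (s + k) i j + (s + k) j i ≠ 0)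
    · obtain ⟨i, j, hij, hne⟩ := hex
      exact hW.commutator_mem_of_symmSingle h2 (hW.symmSingle_mem_of_ne h2 h6 hn3 hij ha hne) hs hl
    · push Not at hex
      have hkt : ∀ r c, k c r = - k r c := fun r c => congr_fun (congr_fun hk r) c
      have hst : ∀ r c, s c r = s r c := fun r c => congr_fun (congr_fun hs r) c
      have hkd : ∀ r, k r r = 0 := fun r => by
        have := hkt r r
        rw [eq_neg_iff_add_eq_zero, ← two_mul] at this
        exact (mul_eq_zero.1 this).resolve_left h2
      have hsc := eq_smul_one_of_forall_ne (s := s) fun i j hij => by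
        obtain ⟨h4, h5⟩ := hex i j hij
        simp only [Matrix.add_apply, hkd, add_zero] at h4 h5
        refine ⟨?_, sub_eq_zero.1 h4⟩
        rw [hkt i j, hst i j] at h5
        have : 2 * s i j = 0 := by linear_combination h5
        exact (mul_eq_zero.1 this).resolve_left h2
      rw [hsc]
      simp
  · obtain ⟨a, ha, haZ⟩ := Set.not_subset.1 hWZ
    obtain ⟨i, j, hij, hne⟩ : ∃ i j, i ≠ j ∧ (a i i - a j j ≠ 0 ∨ a i j + a j i ≠ 0) := by
      by_contra! hex
      refine haZ ?_
      have hst : ∀ r c, a c r = a r c := fun r c => congr_fun (congr_fun (hWS ha) r) c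
      rw [eq_smul_one_of_forall_ne (s := a) fun i j hij => by
        obtain ⟨h4, h5⟩ := hex i j hij
        refine ⟨?_, sub_eq_zero.1 h4⟩
        rw [hst i j] at h5
        have : 2 * a i j = 0 := by linear_combination h5
        exact (mul_eq_zero.1 this).resolve_left h2]
      exact Submodule.smul_mem _ _ (Submodule.mem_span_singleton_self _)
    refine Submodule.span_le.2 ?_
    rintro x ⟨s, hs, l, hl, rfl⟩
    exact hW.commutator_mem_of_symmSingle h2 (hW.symmSingle_mem_of_ne h2 h6 hn3 hij ha hne) hs hl
  · have hstable := isSkewStable_commSpan_symm_skew hmul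
    have hs01 : symmSingle E x1 x2 ∈ commSpan E (symmPart (transposeLin E n) : Set _)
        (skewPart (transposeLin E n) : Set (Matrix (Fin n) (Fin n) E)) := by
      rw [← symmSingle_commutator h01 h02 h12]
      exact commutator_mem_commSpan (symmSingle_mem _ _) (skewSingle_mem _ _)
    have hall := hstable.symmSingle_mem_of_ne h2 h6 hn3 h12 hs01
      (Or.inr (by simpa [symmSingle, h12, h12.symm, one_add_one_eq_two] using h2))
    have : m = (m - m.trace • single x0 x0 1) + m.trace • single x0 x0 1 := by abel
    rw [this]
    refine Submodule.add_mem_sup (hstable.mem_of_symm_of_trace h2 hall ?_ ?_)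
      (Submodule.smul_mem _ _ (Submodule.mem_span_singleton_self _))
    · rw [transpose_sub, transpose_smul, transpose_single, mem_symmPart_transposeLin.1 hm]
    · simp [trace_sub]
  · refine ⟨skewSingle E x0 x1, skewSingle_mem _ _, skewSingle E x1 x2, skewSingle_mem _ _, ?_⟩
    rw [skewSingle_commutator h01 h02 h12]
    intro h
    have := congr_fun (congr_fun h x0) x2
    simp [skewSingle, h02, h02.symm] at this

end Transpose

/-! ### Symplectic involutions -/

section Symplectic

open Matrix

variable {E : Type*} [Field E] {n : ℕ}

/-- The bilinear form `xᵀ H y` with Gram matrix `H`. -/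
def gramForm (H : Matrix (Fin n) (Fin n) E) (x y : Fin n → E) : E := x ⬝ᵥ H *ᵥ y

/-- The skew-symmetric matrix `x yᵀ - y xᵀ`. -/
def wedge (x y : Fin n → E) : Matrix (Fin n) (Fin n) E := vecMulVec x y - vecMulVec y x

/-- Stability of a subspace under `m ↦ m H p - p H m` for all symmetric `p`. If `H` is alternating
and invertible, then right multiplication by `H` identifies these subspaces with those stable under
the skew elements of the involution `a ↦ H⁻¹ aᵀ H`: the skew elements are the `p H` with `p`
symmetric, and `[m H, p H] = (m H p - p H m) H`. -/
def IsGramStable (H : Matrix (Fin n) (Fin n) E) (W : Submodule E (Matrix (Fin n) (Fin n) E)) :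
    Prop :=
  ∀ m ∈ W, ∀ p : Matrix (Fin n) (Fin n) E, pᵀ = p → m * H * p - p * H * m ∈ W

theorem mem_of_transpose_eq_of_vecMulVec_mem (h2 : (2 : E) ≠ 0)
    {W : Submodule E (Matrix (Fin n) (Fin n) E)} (h : ∀ z : Fin n → E, vecMulVec z z ∈ W)
    {m : Matrix (Fin n) (Fin n) E} (hm : mᵀ = m) : m ∈ W := by
  have hs : ∀ k l, symmSingle E k l ∈ W := fun k l => by
    have h1 := h (Pi.single k 1 + Pi.single l 1)
    rw [add_vecMulVec, vecMulVec_add, vecMulVec_add] at h1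
    have h3 := W.sub_mem (W.sub_mem h1 (h (Pi.single k 1))) (h (Pi.single l 1))
    rw [symmSingle, single_eq_single_vecMulVec_single, single_eq_single_vecMulVec_single]
    convert h3 using 1
    abel
  have hexp : (2 : E) • m = ∑ k, ∑ l, m k l • symmSingle E k l := by
    have h1 : ∑ k, ∑ l, m k l • single k l (1 : E) = m := by
      conv_rhs => rw [matrix_eq_sum_single m]
      simp
    have h3 : ∑ k, ∑ l, m k l • single l k (1 : E) = m := by
      rw [Finset.sum_comm]
      conv_rhs => rw [← h1]
      refine Finset.sum_congr rfl fun k _ => Finset.sum_congr rfl fun l _ => ?_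
      conv_lhs => rw [← hm, transpose_apply]
    calc (2 : E) • m = m + m := two_smul _ _
      _ = ∑ k, ∑ l, m k l • single k l (1 : E) + ∑ k, ∑ l, m k l • single l k (1 : E) := by
        rw [h1, h3]
      _ = _ := by simp only [← Finset.sum_add_distrib, ← smul_add, symmSingle]
  have : (2 : E) • m ∈ W := by
    rw [hexp]
    exact Submodule.sum_mem _ fun k _ => Submodule.sum_mem _ fun l _ =>
      Submodule.smul_mem _ _ (hs k l)
  have := W.smul_mem (2 : E)⁻¹ this
  rwa [smul_smul, inv_mul_cancel₀ h2, one_smul] at this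

theorem wedge_swap (x y : Fin n → E) : wedge y x = -wedge x y := by
  simp [wedge]

theorem wedge_self (x : Fin n → E) : wedge x x = 0 := by
  simp [wedge]

theorem wedge_add_right (x y z : Fin n → E) : wedge x (y + z) = wedge x y + wedge x z := by
  simp only [wedge, vecMulVec_add, add_vecMulVec]
  abel

theorem wedge_smul_right (c : E) (x y : Fin n → E) : wedge x (c • y) = c • wedge x y := by
  simp only [wedge, vecMulVec_smul, smul_vecMulVec, smul_sub]

theorem wedge_sub_right (x y z : Fin n → E) : wedge x (y - z) = wedge x y - wedge x z := by
  simp only [wedge, vecMulVec_sub, sub_vecMulVec]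
  abel

theorem transpose_wedge (x y : Fin n → E) : (wedge x y)ᵀ = -wedge x y := by
  simp [wedge, transpose_vecMulVec]

variable {H : Matrix (Fin n) (Fin n) E}

theorem gramForm_add_right (x y z : Fin n → E) :
    gramForm H x (y + z) = gramForm H x y + gramForm H x z := by
  simp [gramForm, mulVec_add]

theorem gramForm_sub_right (x y z : Fin n → E) :
    gramForm H x (y - z) = gramForm H x y - gramForm H x z := by
  simp [gramForm, mulVec_sub]

theorem gramForm_smul_right (c : E) (x y : Fin n → E) :
    gramForm H x (c • y) = c * gramForm H x y := by
  simp [gramForm, mulVec_smul]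

theorem gramForm_swap (hH : Hᵀ = -H) (x y : Fin n → E) : gramForm H y x = -gramForm H x y := by
  rw [gramForm, gramForm, dotProduct_mulVec, ← mulVec_transpose, hH, neg_mulVec, neg_dotProduct,
    dotProduct_comm]

theorem gramForm_self (h2 : (2 : E) ≠ 0) (hH : Hᵀ = -H) (x : Fin n → E) : gramForm H x x = 0 := by
  have := gramForm_swap hH x x
  rw [eq_neg_iff_add_eq_zero, ← two_mul] at this
  exact (mul_eq_zero.1 this).resolve_left h2

theorem exists_gramForm_eq_one {G : Matrix (Fin n) (Fin n) E} (hHG : H * G = 1) {x : Fin n → E}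
    (hx : x ≠ 0) : ∃ y, gramForm H x y = 1 := by
  obtain ⟨i, hi⟩ := Function.ne_iff.1 hx
  refine ⟨G *ᵥ Pi.single i (x i)⁻¹, ?_⟩
  rw [gramForm, mulVec_mulVec, hHG, one_mulVec, dotProduct_single, mul_inv_cancel₀ hi]

theorem exists_gramForm_ne_zero_of_ne_zero {G : Matrix (Fin n) (Fin n) E} (hHG : H * G = 1)
    {x y : Fin n → E} (hx : x ≠ 0) (hy : y ≠ 0) : ∃ t, gramForm H x t ≠ 0 ∧ gramForm H y t ≠ 0 := by
  obtain ⟨a, ha⟩ := exists_gramForm_eq_one hHG hx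
  obtain ⟨b, hb⟩ := exists_gramForm_eq_one hHG hy
  by_cases h1 : gramForm H y a = 0
  · by_cases h3 : gramForm H x b = 0
    · exact ⟨a + b, by simp [gramForm_add_right, ha, h3], by simp [gramForm_add_right, hb, h1]⟩
    · exact ⟨b, h3, by simp [hb]⟩
  · exact ⟨a, by simp [ha], h1⟩

/-- The form is nondegenerate: if `y` is not a multiple of `x`, some vector is orthogonal to `x` but
not to `y`. -/
theorem exists_gramForm_eq_zero_ne_zero {G : Matrix (Fin n) (Fin n) E} (hHG : H * G = 1)
    (hH : Hᵀ = -H) {x y : Fin n → E} (hx : x ≠ 0) (hy : ∀ c : E, y ≠ c • x) :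
    ∃ t, gramForm H x t = 0 ∧ gramForm H y t ≠ 0 := by
  by_contra! h
  obtain ⟨t, ht⟩ := exists_gramForm_eq_one hHG hx
  have h0 : y - gramForm H y t • x ≠ 0 := fun h0 => hy _ (sub_eq_zero.1 h0)
  obtain ⟨w, hw⟩ := exists_gramForm_eq_one hHG h0
  have h1 := h (w - gramForm H x w • t) (by rw [gramForm_sub_right, gramForm_smul_right, ht]; ring)
  rw [gramForm_swap hH, gramForm_sub_right, gramForm_smul_right, gramForm_swap hH y w,
    gramForm_swap hH x w] at hw
  rw [gramForm_sub_right, gramForm_smul_right] at h1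
  apply zero_ne_one (α := E)
  rw [← hw]
  linear_combination -h1

theorem exists_ne_zero_gramForm_eq_zero (hn : 3 ≤ n) (x z : Fin n → E) :
    ∃ y, y ≠ 0 ∧ gramForm H x y = 0 ∧ gramForm H z y = 0 := by
  let f : (Fin n → E) →ₗ[E] E × E :=
    { toFun := fun y => (gramForm H x y, gramForm H z y)
      map_add' := fun a b => by simp [gramForm_add_right]
      map_smul' := fun a b => by simp [gramForm_smul_right] }
  have hf : LinearMap.ker f ≠ ⊥ := LinearMap.ker_ne_bot_of_finrank_lt (by
    simp only [Module.finrank_prod, Module.finrank_self, Module.finrank_fin_fun]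
    omega)
  obtain ⟨y, hy, hy0⟩ := Submodule.exists_mem_ne_zero_of_ne_bot hf
  have hy' : (gramForm H x y, gramForm H z y) = 0 := hy
  exact ⟨y, hy0, congrArg Prod.fst hy', congrArg Prod.snd hy'⟩

theorem commutator_vecMulVec_self (hH : Hᵀ = -H) {m : Matrix (Fin n) (Fin n) E} (hm : mᵀ = -m)
    (z : Fin n → E) :
    m * H * vecMulVec z z - vecMulVec z z * H * m = wedge ((m * H) *ᵥ z) z := by
  have : z ᵥ* (H * m) = (m * H) *ᵥ z := by
    rw [← mulVec_transpose, transpose_mul, hm, hH, neg_mul_neg]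
  rw [mul_vecMulVec, Matrix.mul_assoc (vecMulVec z z), vecMulVec_mul, this, wedge]

theorem wedge_mul_mulVec (x y z : Fin n → E) :
    (wedge x y * H) *ᵥ z = gramForm H y z • x - gramForm H x z • y := by
  rw [← mulVec_mulVec, wedge, sub_mulVec, vecMulVec_mulVec, vecMulVec_mulVec]
  ext i
  simp [gramForm]

/-- The double commutator of `m` with `p = z zᵀ` is `-2 p H m H p`, a multiple of `p`, because
`p H p = 0`. -/
theorem IsGramStable.vecMulVec_self_mem (h2 : (2 : E) ≠ 0) (hH : Hᵀ = -H)
    {W : Submodule E (Matrix (Fin n) (Fin n) E)} (hW : IsGramStable H W)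
    {m : Matrix (Fin n) (Fin n) E} (hm : m ∈ W) {z : Fin n → E}
    (hz : gramForm (H * m * H) z z ≠ 0) : vecMulVec z z ∈ W := by
  set p := vecMulVec z z with hp
  have hpt : pᵀ = p := transpose_vecMulVec _ _
  have hpMp : ∀ M : Matrix (Fin n) (Fin n) E, p * M * p = gramForm M z z • p := fun M => by
    rw [Matrix.mul_assoc, hp, mul_vecMulVec, vecMulVec_mul_vecMulVec, vecMulVec_smul]
    rfl
  have h1 := hW _ (hW _ hm p hpt) p hpt
  have h3 : (m * H * p - p * H * m) * H * p - p * H * (m * H * p - p * H * m) =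
      m * H * (p * H * p) + (p * H * p) * H * m - (2 : ℕ) • (p * (H * m * H) * p) := by
    noncomm_ring
  rw [h3, hpMp, hpMp, gramForm_self h2 hH, ← Nat.cast_smul_eq_nsmul E] at h1
  simp only [zero_smul, mul_zero, zero_mul, zero_add, zero_sub, neg_mem_iff, smul_smul] at h1
  have := W.smul_mem (((2 : ℕ) : E) * gramForm (H * m * H) z z)⁻¹ h1
  rwa [smul_smul, inv_mul_cancel₀ (mul_ne_zero (by exact_mod_cast h2) hz), one_smul] at this

/-- A subspace stable under the symplectic Lie algebra either consists of elements symmetric for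
the symplectic involution or contains the whole symplectic Lie algebra. -/
theorem IsGramStable.mem_of_transpose_eq (h2 : (2 : E) ≠ 0) {G : Matrix (Fin n) (Fin n) E}
    (hHG : H * G = 1) (hH : Hᵀ = -H)
    {W : Submodule E (Matrix (Fin n) (Fin n) E)} (hW : IsGramStable H W)
    {m : Matrix (Fin n) (Fin n) E} (hm : m ∈ W) (hm' : mᵀ ≠ -m)
    {p : Matrix (Fin n) (Fin n) E} (hp : pᵀ = p) : p ∈ W := by
  have hgram : ∀ (M : Matrix (Fin n) (Fin n) E) z, gramForm (H * M * H) z z =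
      -gramForm M (H *ᵥ z) (H *ᵥ z) := by
    intro M z
    rw [gramForm, gramForm, ← mulVec_mulVec, ← mulVec_mulVec, dotProduct_mulVec,
      ← mulVec_transpose, hH, neg_mulVec, neg_dotProduct]
  obtain ⟨u, hu⟩ : ∃ u, gramForm m u u ≠ 0 := by
    by_contra! h
    apply hm'
    ext i j
    have h1 := h (Pi.single i 1 + Pi.single j 1)
    have hi := h (Pi.single i 1)
    have hj := h (Pi.single j 1)
    simp only [gramForm, mulVec_add, add_dotProduct, dotProduct_add, mulVec_single_one,
      single_one_dotProduct, col_apply] at h1 hi hj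
    rw [transpose_apply, Matrix.neg_apply]
    linear_combination h1 - hi - hj
  have hx : gramForm (H * m * H) (G *ᵥ u) (G *ᵥ u) ≠ 0 := by
    rw [hgram, mulVec_mulVec, hHG, one_mulVec]
    exact neg_ne_zero.2 hu
  have hx0 : G *ᵥ u ≠ 0 := fun h => hx (by rw [h, gramForm, mulVec_zero, dotProduct_zero])
  have hxW := hW.vecMulVec_self_mem h2 hH hm hx
  have step : ∀ {x y}, vecMulVec x x ∈ W → gramForm H x y ≠ 0 → vecMulVec y y ∈ W := by
    intro x y hx hxy
    refine hW.vecMulVec_self_mem h2 hH hx ?_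
    have : gramForm (H * vecMulVec x x * H) y y = -(gramForm H x y * gramForm H x y) := by
      rw [hgram, gramForm, vecMulVec_mulVec]
      simp [gramForm, dotProduct_comm]
    rw [this]
    exact neg_ne_zero.2 (mul_ne_zero hxy hxy)
  refine mem_of_transpose_eq_of_vecMulVec_mem h2 (fun z => ?_) hp
  by_cases hz : z = 0
  · simp [hz]
  obtain ⟨t, ht1, ht2⟩ := exists_gramForm_ne_zero_of_ne_zero hHG hx0 hz
  exact step (step hxW ht1) (by rw [gramForm_swap hH]; exact neg_ne_zero.2 ht2)

theorem IsGramStable.wedge_mem (hH : Hᵀ = -H)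
    {W : Submodule E (Matrix (Fin n) (Fin n) E)} (hW : IsGramStable H W) {x y z : Fin n → E}
    (h : wedge x y ∈ W) (hxz : gramForm H x z = 0) (hyz : gramForm H y z ≠ 0) : wedge x z ∈ W := by
  have h1 := hW _ h _ (transpose_vecMulVec z z)
  rw [commutator_vecMulVec_self hH (transpose_wedge x y), wedge_mul_mulVec, hxz, zero_smul,
    sub_zero, wedge_swap, wedge_smul_right, ← smul_neg, ← wedge_swap] at h1
  have := W.smul_mem (gramForm H y z)⁻¹ h1
  rwa [smul_smul, inv_mul_cancel₀ hyz, one_smul] at this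

/-- One wedge `x ∧ y` with `y` outside the line of `x` produces all `x ∧ w` with `w ⊥ x`. -/
theorem IsGramStable.wedge_mem_of_gramForm_eq_zero {G : Matrix (Fin n) (Fin n) E}
    (hHG : H * G = 1) (hH : Hᵀ = -H)
    {W : Submodule E (Matrix (Fin n) (Fin n) E)} (hW : IsGramStable H W) {x y : Fin n → E}
    (hx : x ≠ 0) (hy : ∀ c : E, y ≠ c • x) (h : wedge x y ∈ W) {w : Fin n → E}
    (hw : gramForm H x w = 0) : wedge x w ∈ W := by
  by_cases hyw : gramForm H y w = 0
  · obtain ⟨t, ht1, ht2⟩ := exists_gramForm_eq_zero_ne_zero hHG hH hx hy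
    have h1 := hW.wedge_mem hH h ht1 ht2
    have h3 := hW.wedge_mem hH h (z := t + w) (by rw [gramForm_add_right, ht1, hw, add_zero])
      (by rwa [gramForm_add_right, hyw, add_zero])
    rw [wedge_add_right] at h3
    exact (Submodule.add_mem_iff_right W h1).1 h3
  · exact hW.wedge_mem hH h hw hyw

/-- Transitivity of the symplectic Lie algebra on the wedges of orthogonal vectors. -/
theorem IsGramStable.all_wedge_mem (hn : 3 ≤ n) {G : Matrix (Fin n) (Fin n) E}
    (hHG : H * G = 1) (hH : Hᵀ = -H)
    {W : Submodule E (Matrix (Fin n) (Fin n) E)} (hW : IsGramStable H W) {x y : Fin n → E}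
    (hx : x ≠ 0) (hy : ∀ c : E, y ≠ c • x) (h : wedge x y ∈ W) {z w : Fin n → E}
    (hzw : gramForm H z w = 0) : wedge z w ∈ W := by
  have neg_mem_swap : ∀ {a b}, wedge a b ∈ W → wedge b a ∈ W := fun {a b} h => by
    rw [wedge_swap]
    exact W.neg_mem h
  -- Pass from `x` to `z` through some `y ≠ 0` orthogonal to both, which exists because `3 ≤ n`.
  have step : ∀ {x z : Fin n → E}, gramForm H x z ≠ 0 →
      (∀ w, gramForm H x w = 0 → wedge x w ∈ W) → ∀ w, gramForm H z w = 0 → wedge z w ∈ W := by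
    intro x z hxz hPx w hzw
    obtain ⟨y, hy0, hxy, hzy⟩ := exists_ne_zero_gramForm_eq_zero (H := H) hn x z
    have hz0 : z ≠ 0 := by
      rintro rfl
      exact hxz (by rw [gramForm, mulVec_zero, dotProduct_zero])
    have hyz : wedge y z ∈ W := by
      refine hW.wedge_mem_of_gramForm_eq_zero hHG hH hy0 ?_ (neg_mem_swap (hPx y hxy))
        (by rw [gramForm_swap hH, hzy, neg_zero])
      rintro c rfl
      rw [gramForm_swap hH, gramForm_smul_right, hzy] at hxz
      simp at hxz
    refine hW.wedge_mem_of_gramForm_eq_zero hHG hH hz0 ?_ (neg_mem_swap hyz) hzw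
    rintro c rfl
    rw [gramForm_smul_right] at hxy
    rcases mul_eq_zero.1 hxy with h | h
    · exact hy0 (by rw [h, zero_smul])
    · exact hxz h
  by_cases hz : z = 0
  · subst hz
    simp [wedge]
  obtain ⟨t, ht1, ht2⟩ := exists_gramForm_ne_zero_of_ne_zero hHG hx hz
  exact step (by rw [gramForm_swap hH]; exact neg_ne_zero.2 ht2)
    (step ht1 fun w hw => hW.wedge_mem_of_gramForm_eq_zero hHG hH hx hy h hw) w hzw

theorem mem_of_transpose_eq_neg_of_wedge_mem (h2 : (2 : E) ≠ 0)
    {W : Submodule E (Matrix (Fin n) (Fin n) E)} (h : ∀ x y : Fin n → E, wedge x y ∈ W)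
    {m : Matrix (Fin n) (Fin n) E} (hm : mᵀ = -m) : m ∈ W := by
  refine skewPart_le_of_skewSingle_mem h2 (fun k l => ?_) hm
  have := h (Pi.single k 1) (Pi.single l 1)
  rwa [wedge, ← single_eq_single_vecMulVec_single, ← single_eq_single_vecMulVec_single] at this

/-- The dichotomy for the involution `a ↦ H⁻¹ aᵀ H` with `H` alternating. -/
theorem hasSkewStableDichotomy_of_transpose_eq_neg (h2 : (2 : E) ≠ 0) (hn : 3 ≤ n)
    {G H : Matrix (Fin n) (Fin n) E} (hGH : G * H = 1) (hHG : H * G = 1) (hH : Hᵀ = -H)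
    (τ : Matrix (Fin n) (Fin n) E →ₗ[E] Matrix (Fin n) (Fin n) E)
    (hτ : ∀ a, τ a = G * aᵀ * H) : HasSkewStableDichotomy τ := by
  have hmul : ∀ a b, τ (a * b) = τ b * τ a := fun a b => by
    rw [hτ, hτ, hτ, transpose_mul]
    calc G * (bᵀ * aᵀ) * H = G * bᵀ * 1 * aᵀ * H := by simp only [Matrix.mul_assoc, Matrix.one_mul]
      _ = _ := by rw [← hHG]; simp only [Matrix.mul_assoc]
  have hτH : ∀ m, τ (m * H) = -(mᵀ * H) := fun m => by
    rw [hτ, transpose_mul, hH, neg_mul, mul_neg, ← Matrix.mul_assoc, hGH, one_mul, neg_mul]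
  have cancel : ∀ {m m' : Matrix (Fin n) (Fin n) E}, m * H = m' * H → m = m' := by
    intro m m' h
    have := congrArg (· * G) h
    simpa [Matrix.mul_assoc, hHG] using this
  have hS : ∀ {m}, m * H ∈ symmPart τ ↔ mᵀ = -m := by
    intro m
    rw [mem_symmPart, hτH]
    refine ⟨fun h => ?_, fun h => by rw [h, neg_mul, neg_neg]⟩
    rw [← neg_mul] at h
    exact neg_eq_iff_eq_neg.1 (cancel h)
  have hK : ∀ {m}, m * H ∈ skewPart τ ↔ mᵀ = m := by
    intro m
    rw [mem_skewPart, hτH, neg_inj]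
    exact ⟨cancel, fun h => by rw [h]⟩
  let R : Matrix (Fin n) (Fin n) E →ₗ[E] Matrix (Fin n) (Fin n) E := LinearMap.mulRight E H
  have hR : ∀ {W : Submodule E (Matrix (Fin n) (Fin n) E)} {m}, m ∈ W.comap R ↔ m * H ∈ W :=
    Iff.rfl
  have hGHm : ∀ a : Matrix (Fin n) (Fin n) E, a * G * H = a := fun a => by
    rw [Matrix.mul_assoc, hGH, mul_one]
  have hstable : ∀ {W}, IsSkewStable τ W → IsGramStable H (W.comap R) := by
    intro W hW m hm p hp
    have := hW _ hm _ (hK.2 hp)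
    rw [hR]
    convert this using 1
    simp only [R, LinearMap.mulRight_apply, sub_mul, Matrix.mul_assoc]
  set D := commSpan E (symmPart τ : Set (Matrix (Fin n) (Fin n) E)) (skewPart τ : Set _) with hD
  have hcomm : ∀ {m p : Matrix (Fin n) (Fin n) E}, mᵀ = -m → pᵀ = p →
      m * H * p - p * H * m ∈ D.comap R := by
    intro m p hm hp
    have h := commutator_mem_commSpan (E := E) (hS.2 hm) (hK.2 hp)
    rw [hR, hD]
    convert h using 1
    simp only [sub_mul, Matrix.mul_assoc]
  have hperp : ∀ {m : Matrix (Fin n) (Fin n) E}, mᵀ = -m → ∀ z,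
      gramForm H z ((m * H) *ᵥ z) = 0 := by
    intro m hm z
    have h1 : (H * (m * H))ᵀ = -(H * (m * H)) := by
      simp only [transpose_mul, hm, hH, neg_mul, mul_neg, neg_neg, Matrix.mul_assoc]
    have := gramForm_self h2 h1 z
    rwa [gramForm, ← mulVec_mulVec] at this
  let x0 : Fin n → E := Pi.single ⟨0, by omega⟩ 1
  have hx0 : x0 ≠ 0 := by simp [x0]
  obtain ⟨y0, hy0⟩ := exists_gramForm_eq_one hHG hx0
  refine ⟨fun W hW hWS => ?_, fun W hW hWS hWZ => ?_, ⟨wedge x0 y0 * H, fun a ha => ?_⟩, ?_⟩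
  · obtain ⟨a, ha, haS⟩ := Set.not_subset.1 hWS
    intro k hk
    have hk' : k * G * H ∈ skewPart τ := by rwa [hGHm]
    have := (hstable hW).mem_of_transpose_eq h2 hHG hH (m := a * G) (by rwa [hR, hGHm])
      (fun h => haS (by have := hS.2 h; rwa [hGHm] at this)) (hK.1 hk')
    rwa [hR, hGHm] at this
  · obtain ⟨a, ha, haZ⟩ := Set.not_subset.1 hWZ
    have hat : (a * G)ᵀ = -(a * G) := hS.1 (by rw [hGHm]; exact hWS ha)
    have haW : a * G ∈ W.comap R := by rwa [hR, hGHm]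
    obtain ⟨z, hz⟩ : ∃ z, LinearIndependent E ![z, a *ᵥ z] := by
      by_contra! h
      obtain ⟨c, hc⟩ := LinearMap.exists_eq_smul_id_of_forall_notLinearIndependent
        (f := toLin' a) (fun v => by simpa using h v)
      apply haZ
      have : a = c • 1 := by
        apply (toLin' (R := E)).injective
        rw [hc, map_smul, toLin'_one]
        rfl
      rw [this]
      exact Submodule.smul_mem _ _ (Submodule.mem_span_singleton_self _)
    have hz0 : z ≠ 0 := by simpa using hz.ne_zero 0
    have hza : ∀ c : E, a *ᵥ z ≠ c • z := fun c h =>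
      (LinearIndependent.pair_iff' hz0).1 hz c h.symm
    have hw : wedge z (a *ᵥ z) ∈ W.comap R := by
      have := (hstable hW) _ haW _ (transpose_vecMulVec z z)
      rw [commutator_vecMulVec_self hH hat, hGHm, wedge_swap] at this
      exact neg_mem_iff.1 this
    have hall : ∀ {x y}, gramForm H x y = 0 → wedge x y ∈ W.comap R := fun h =>
      (hstable hW).all_wedge_mem hn hHG hH hz0 hza hw h
    refine Submodule.span_le.2 ?_
    rintro x ⟨s, hs, k, hk, rfl⟩
    have hst : (s * G)ᵀ = -(s * G) := hS.1 (by rwa [hGHm])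
    have hkt : (k * G)ᵀ = k * G := hK.1 (by rwa [hGHm])
    let T : Matrix (Fin n) (Fin n) E →ₗ[E] Matrix (Fin n) (Fin n) E :=
      LinearMap.mulLeft E (s * G * H) - LinearMap.mulRight E (H * (s * G))
    have hT : k * G ∈ (W.comap R).comap T := by
      refine mem_of_transpose_eq_of_vecMulVec_mem h2 (fun z => ?_) hkt
      have : T (vecMulVec z z) = wedge ((s * G * H) *ᵥ z) z := by
        rw [← commutator_vecMulVec_self hH hst]
        simp only [T, LinearMap.sub_apply, LinearMap.mulLeft_apply, LinearMap.mulRight_apply,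
          Matrix.mul_assoc]
      rw [Submodule.mem_comap, this, wedge_swap]
      exact neg_mem (hall (hperp hst z))
    have h3 : T (k * G) * H ∈ W := hT
    change s * k - k * s ∈ W
    convert h3 using 1
    simp only [T, LinearMap.sub_apply, LinearMap.mulLeft_apply, LinearMap.mulRight_apply, sub_mul,
      Matrix.mul_assoc, hGH, mul_one]
    simp only [← Matrix.mul_assoc, hGHm]
  · have horth : ∀ {x w}, gramForm H x w = 0 → wedge x w ∈ D.comap R := by
      intro x w hxw
      by_cases hx : x = 0
      · subst hx
        simp [wedge]
      by_cases hw : ∃ c : E, w = c • x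
      · obtain ⟨c, rfl⟩ := hw
        rw [wedge_smul_right, wedge_self, smul_zero]
        exact zero_mem _
      push Not at hw
      obtain ⟨t, ht1, ht2⟩ := exists_gramForm_eq_zero_ne_zero hHG hH hx hw
      have h1 := hcomm (transpose_wedge x t) (transpose_vecMulVec w w)
      rw [commutator_vecMulVec_self hH (transpose_wedge x t), wedge_mul_mulVec, hxw, zero_smul,
        sub_zero, wedge_swap, wedge_smul_right, ← smul_neg, ← wedge_swap] at h1
      have htw : gramForm H t w ≠ 0 := by
        rw [gramForm_swap hH]
        exact neg_ne_zero.2 ht2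
      have := Submodule.smul_mem _ (gramForm H t w)⁻¹ h1
      rwa [smul_smul, inv_mul_cancel₀ htw, one_smul] at this
    -- All wedges agree modulo `[S, K]`, up to the scalar `gramForm H x y`.
    have step : ∀ {x z : Fin n → E}, gramForm H x z ≠ 0 →
        (∀ w, wedge x w - gramForm H x w • wedge x0 y0 ∈ D.comap R) →
        ∀ w, wedge z w - gramForm H z w • wedge x0 y0 ∈ D.comap R := by
      intro x z hxz hx w
      have hzx : gramForm H z x ≠ 0 := by
        rw [gramForm_swap hH]
        exact neg_ne_zero.2 hxz
      have h1 := horth (x := z) (w := w - (gramForm H z w / gramForm H z x) • x) (by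
        rw [gramForm_sub_right, gramForm_smul_right, div_mul_cancel₀ _ hzx, sub_self])
      have h3 := Submodule.smul_mem _ (gramForm H z w / gramForm H z x) (hx z)
      have h4 := Submodule.sub_mem _ h1 h3
      convert h4 using 1
      rw [wedge_sub_right, wedge_smul_right, wedge_swap x z, gramForm_swap hH z x]
      have : gramForm H z w • wedge x0 y0 =
          (gramForm H z w / gramForm H z x * gramForm H z x) • wedge x0 y0 := by
        rw [div_mul_cancel₀ _ hzx]
      rw [this]
      module
    have hbase : ∀ w, wedge x0 w - gramForm H x0 w • wedge x0 y0 ∈ D.comap R := by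
      intro w
      rw [← wedge_smul_right, ← wedge_sub_right]
      exact horth (by rw [gramForm_sub_right, gramForm_smul_right, hy0, mul_one, sub_self])
    have hall : ∀ z w, wedge z w - gramForm H z w • wedge x0 y0 ∈ D.comap R := by
      intro z
      by_cases hz : z = 0
      · subst hz
        simp [wedge, gramForm]
      obtain ⟨t, ht1, ht2⟩ := exists_gramForm_ne_zero_of_ne_zero hHG hx0 hz
      exact step (by rw [gramForm_swap hH]; exact neg_ne_zero.2 ht2) (step ht1 hbase)
    have hat : (a * G)ᵀ = -(a * G) := hS.1 (by rwa [hGHm])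
    have := mem_of_transpose_eq_neg_of_wedge_mem h2
      (W := (D ⊔ Submodule.span E {wedge x0 y0 * H}).comap R) (fun z w => ?_) hat
    · rwa [hR, hGHm] at this
    · rw [hR]
      have h1 : wedge z w * H = (wedge z w - gramForm H z w • wedge x0 y0) * H +
          gramForm H z w • (wedge x0 y0 * H) := by
        rw [sub_mul, smul_mul_assoc, sub_add_cancel]
      rw [h1]
      exact Submodule.add_mem_sup (hall z w)
        (Submodule.smul_mem _ _ (Submodule.mem_span_singleton_self _))
  · refine ⟨_, hK.2 (transpose_vecMulVec x0 x0), _, hK.2 (transpose_vecMulVec y0 y0), fun h => ?_⟩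
    have h1 : (vecMulVec x0 x0 * H * (vecMulVec y0 y0 * H) -
        vecMulVec y0 y0 * H * (vecMulVec x0 x0 * H)) *ᵥ x0 = -x0 := by
      have happ : ∀ x y z : Fin n → E, (vecMulVec x y * H) *ᵥ z = gramForm H y z • x := by
        intro x y z
        rw [← mulVec_mulVec, vecMulVec_mulVec]
        ext i
        simp [gramForm, mul_comm]
      rw [sub_mulVec, ← mulVec_mulVec x0 (vecMulVec x0 x0 * H),
        ← mulVec_mulVec x0 (vecMulVec y0 y0 * H)]
      rw [happ x0 x0 x0, happ y0 y0 x0, mulVec_smul, mulVec_smul, happ, happ, gramForm_self h2 hH,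
        gramForm_swap hH x0 y0, hy0]
      simp
    rw [h, zero_mulVec] at h1
    exact hx0 (neg_eq_zero.1 h1.symm)

end Symplectic

/-! ### Lie ideals of matrix algebras -/

section LieIdeal

open Matrix

variable {E : Type*} [Field E] {n : ℕ} {W : Submodule E (Matrix (Fin n) (Fin n) E)}

/-- The double commutator of `a` with the square zero matrix `E_ij` is `-2 a_ji E_ij`. -/
theorem single_mem_of_apply_ne_zero (h2 : (2 : E) ≠ 0) (hW : ∀ x ∈ W, ∀ a, x * a - a * x ∈ W)
    {a : Matrix (Fin n) (Fin n) E} (ha : a ∈ W) {i j : Fin n} (hij : i ≠ j) (hne : a j i ≠ 0) :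
    single i j 1 ∈ W := by
  have h := hW _ (hW _ ha (single i j 1)) (single i j 1)
  have h1 : (a * single i j 1 - single i j 1 * a) * single i j 1 -
      single i j 1 * (a * single i j 1 - single i j 1 * a) = (-2 * a j i) • single i j (1 : E) := by
    have h3 : (a * single i j 1 - single i j 1 * a) * single i j 1 -
      single i j 1 * (a * single i j 1 - single i j 1 * a) =
      a * (single i j 1 * single i j 1) + (single i j 1 * single i j 1) * a -
        (2 : ℕ) • (single i j 1 * a * single i j 1) := by noncomm_ring
    rw [h3, single_mul_mul_single, single_mul_single_of_ne _ _ _ _ hij.symm,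
      ← Nat.cast_smul_eq_nsmul E]
    simp
  rw [h1] at h
  have := W.smul_mem (-2 * a j i)⁻¹ h
  rwa [smul_smul, inv_mul_cancel₀ (mul_ne_zero (neg_ne_zero.2 h2) hne), one_smul] at this

theorem mem_of_trace_eq_zero (h : ∀ k l, k ≠ l → single k l (1 : E) ∈ W)
    (hd : ∀ k l, single k k (1 : E) - single l l 1 ∈ W) {m : Matrix (Fin n) (Fin n) E}
    (htr : m.trace = 0) : m ∈ W := by
  rcases Nat.eq_zero_or_pos n with hn | hn
  · subst hn
    rw [Subsingleton.elim m 0]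
    exact W.zero_mem
  let o : Fin n := ⟨0, hn⟩
  have hexp : m = ∑ k, ∑ l, m k l • (single k l (1 : E) - if k = l then single o o 1 else 0) := by
    have h4 : ∑ k, ∑ l, m k l • (if k = l then single o o (1 : E) else 0) = 0 := by
      simp only [smul_ite, smul_zero, Finset.sum_ite_eq, Finset.mem_univ, if_true]
      rw [← Finset.sum_smul]
      have : ∑ k, m k k = 0 := htr
      rw [this, zero_smul]
    simp only [smul_sub, Finset.sum_sub_distrib]
    rw [h4, sub_zero]
    conv_lhs => rw [matrix_eq_sum_single m]
    simp
  rw [hexp]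
  refine Submodule.sum_mem _ fun k _ => Submodule.sum_mem _ fun l _ => Submodule.smul_mem _ _ ?_
  split_ifs with hkl
  · subst hkl
    exact hd _ _
  · rw [sub_zero]
    exact h k l hkl

/-- A Lie ideal of a matrix algebra is central or contains all commutators. -/
theorem commSpan_univ_le_of_not_le (h2 : (2 : E) ≠ 0) (hW : ∀ x ∈ W, ∀ a, x * a - a * x ∈ W)
    (hWZ : ¬ W ≤ Submodule.span E {1}) : commSpan E Set.univ Set.univ ≤ W := by
  obtain ⟨a, ha, haZ⟩ := Set.not_subset.1 hWZ
  have hn : NeZero n := ⟨by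
    rintro rfl
    exact haZ (by rw [Subsingleton.elim a 0]; exact Submodule.zero_mem _)⟩
  obtain ⟨i, j, hij, h⟩ : ∃ i j, i ≠ j ∧ single i j (1 : E) ∈ W := by
    by_cases hex : ∃ i j, i ≠ j ∧ a j i ≠ 0
    · obtain ⟨i, j, hij, hne⟩ := hex
      exact ⟨i, j, hij, single_mem_of_apply_ne_zero h2 hW ha hij hne⟩
    · push Not at hex
      obtain ⟨i, j, hij, hne⟩ : ∃ i j, i ≠ j ∧ a i i ≠ a j j := by
        by_contra! hd
        refine haZ ?_
        rw [eq_smul_one_of_forall_ne fun i j hij => ⟨hex j i hij.symm, hd i j hij⟩]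
        exact Submodule.smul_mem _ _ (Submodule.mem_span_singleton_self _)
      refine ⟨j, i, hij.symm,
        single_mem_of_apply_ne_zero h2 hW (hW a ha (single i j 1)) hij.symm ?_⟩
      simpa [sub_eq_zero] using hne
  have flip : ∀ {p q : Fin n}, p ≠ q → single p q (1 : E) ∈ W → single q p (1 : E) ∈ W :=
    fun hpq h => single_mem_of_apply_ne_zero h2 hW h hpq.symm (by simp)
  have row : ∀ {p q r : Fin n}, p ≠ q → r ≠ p → single p q (1 : E) ∈ W →
      single p r (1 : E) ∈ W := by
    intro p q r hpq hrp h
    simpa [hrp] using hW _ h (single q r 1)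
  have hall : ∀ k l, k ≠ l → single k l (1 : E) ∈ W := by
    intro k l hkl
    by_cases hki : k = i
    · subst hki
      exact row hij hkl.symm h
    · exact row hki hkl.symm (flip (Ne.symm hki) (row hij hki h))
  refine Submodule.span_le.2 ?_
  rintro x ⟨u, -, v, -, rfl⟩
  refine mem_of_trace_eq_zero hall (fun k l => ?_) (by rw [trace_sub, trace_mul_comm, sub_self])
  by_cases hkl : k = l
  · simp [hkl]
  · simpa using hW _ (hall k l hkl) (single l k 1)

theorem exists_top_le_commSpan_univ_sup (E : Type*) [Field E] (n : ℕ) :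
    ∃ s, (⊤ : Submodule E (Matrix (Fin n) (Fin n) E)) ≤
      commSpan E Set.univ Set.univ ⊔ Submodule.span E {s} := by
  rcases Nat.eq_zero_or_pos n with hn | hn
  · subst hn
    refine ⟨0, fun m _ => ?_⟩
    rw [Subsingleton.elim m 0]
    exact Submodule.zero_mem _
  let o : Fin n := ⟨0, hn⟩
  refine ⟨single o o 1, fun m _ => ?_⟩
  have : m = (m - m.trace • single o o 1) + m.trace • single o o 1 := by abel
  rw [this]
  refine Submodule.add_mem_sup (mem_of_trace_eq_zero (fun k l hkl => ?_) (fun k l => ?_)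
    (by simp [trace_sub])) (Submodule.smul_mem _ _ (Submodule.mem_span_singleton_self _))
  · have := commutator_mem_commSpan (E := E) (Set.mem_univ (single k l (1 : E)))
      (Set.mem_univ (single l l (1 : E)))
    simpa [hkl, hkl.symm] using this
  · have := commutator_mem_commSpan (E := E) (Set.mem_univ (single k l (1 : E)))
      (Set.mem_univ (single l k (1 : E)))
    simpa using this

theorem lieIdeal_classification (h2 : (2 : E) ≠ 0) (hW : ∀ x ∈ W, ∀ a, x * a - a * x ∈ W) :
    W = ⊥ ∨ W = Submodule.span E {1} ∨ W = commSpan E Set.univ Set.univ ∨ W = ⊤ := by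
  by_cases h : W ≤ Submodule.span E {1}
  · rcases eq_or_eq_of_le_sup_span bot_le h (bot_sup_eq _).ge with h | h <;> simp [h]
  · obtain ⟨s, hs⟩ := exists_top_le_commSpan_univ_sup E n
    rcases eq_or_eq_of_le_sup_span (commSpan_univ_le_of_not_le h2 hW h) le_top hs with h | h <;>
      simp [h]

end LieIdeal

/-! ### Descent along a scalar extension -/

section Descent

variable {F E A B : Type*} [Field F] [Field E] [Algebra F E] [Ring A] [Algebra F A]
  [Ring B] [Algebra E B] [Algebra F B]

/-- An `F`-algebra map `ι : A → B` together with a retraction which exhibit the `E`-algebra `B` as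
the scalar extension of `A` from `F` to `E`. -/
structure IsScalarExtension (ι : A →ₐ[F] B) (r : E →ₗ[F] F) (ρ : B →ₗ[F] A) : Prop where
  map_one : r 1 = 1
  span_range : Submodule.span E (Set.range ι) = ⊤
  retraction : ∀ (e : E) (a : A), ρ (e • ι a) = r e • a

/-- Commutator spans commute with scalar extension. -/
theorem commSpan_span_image [IsScalarTower F E B] (ι : A →ₐ[F] B) (U V : Set A) :
    commSpan E (Submodule.span E (ι '' U) : Set B) (Submodule.span E (ι '' V) : Set B) =
      Submodule.span E (ι '' (commSpan F U V : Set A)) := by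
  refine le_antisymm (Submodule.span_le.2 ?_) (Submodule.span_le.2 ?_)
  · rintro x ⟨u, hu, v, hv, rfl⟩
    induction hu using Submodule.span_induction with
    | zero => simp
    | add x y _ _ hx hy =>
      have : (x + y) * v - v * (x + y) = (x * v - v * x) + (y * v - v * y) := by noncomm_ring
      rw [this]
      exact Submodule.add_mem _ hx hy
    | smul c x _ hx =>
      rw [smul_mul_assoc, mul_smul_comm, ← smul_sub]
      exact Submodule.smul_mem _ _ hx
    | mem u hu =>
      obtain ⟨a, ha, rfl⟩ := hu
      induction hv using Submodule.span_induction with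
      | zero => simp
      | add x y _ _ hx hy =>
        have : ι a * (x + y) - (x + y) * ι a = (ι a * x - x * ι a) + (ι a * y - y * ι a) := by
          noncomm_ring
        rw [this]
        exact Submodule.add_mem _ hx hy
      | smul c x _ hx =>
        rw [smul_mul_assoc, mul_smul_comm, ← smul_sub]
        exact Submodule.smul_mem _ _ hx
      | mem v hv =>
        obtain ⟨b, hb, rfl⟩ := hv
        exact Submodule.subset_span ⟨_, commutator_mem_commSpan ha hb, by simp⟩
  · rintro _ ⟨x, hx, rfl⟩
    induction hx using Submodule.span_induction with
    | zero => simp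
    | add x y _ _ hx hy => rw [map_add]; exact Submodule.add_mem _ hx hy
    | smul c x _ hx =>
      rw [map_smul, ← algebraMap_smul E c (ι x)]
      exact Submodule.smul_mem _ _ hx
    | mem x hx =>
      obtain ⟨u, hu, v, hv, rfl⟩ := hx
      rw [map_sub, map_mul, map_mul]
      exact commutator_mem_commSpan (Submodule.subset_span ⟨u, hu, rfl⟩)
        (Submodule.subset_span ⟨v, hv, rfl⟩)

namespace IsScalarExtension

variable {ι : A →ₐ[F] B} {r : E →ₗ[F] F} {ρ : B →ₗ[F] A}

theorem retraction_apply (h : IsScalarExtension ι r ρ) (a : A) : ρ (ι a) = a := by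
  have := h.retraction 1 a
  rwa [one_smul, h.map_one, one_smul] at this

theorem injective (h : IsScalarExtension ι r ρ) : Function.Injective ι :=
  Function.LeftInverse.injective h.retraction_apply

/-- A subspace of `A` is recovered from the `E`-subspace of `B` it spans. -/
theorem mem_span_image_iff (h : IsScalarExtension ι r ρ) (L : Submodule F A) (a : A) :
    ι a ∈ Submodule.span E (ι '' (L : Set A)) ↔ a ∈ L := by
  refine ⟨fun ha => ?_, fun ha => Submodule.subset_span ⟨a, ha, rfl⟩⟩
  have key : ∀ x ∈ Submodule.span E (ι '' (L : Set A)), ∀ e : E, ρ (e • x) ∈ L := by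
    intro x hx
    induction hx using Submodule.span_induction with
    | zero => simp
    | add x y _ _ hx hy => exact fun e => by rw [smul_add, map_add]; exact L.add_mem (hx e) (hy e)
    | smul c x _ hx => exact fun e => by rw [smul_smul]; exact hx _
    | mem x hx =>
      obtain ⟨b, hb, rfl⟩ := hx
      exact fun e => by rw [h.retraction]; exact L.smul_mem _ hb
  have := key _ ha 1
  rwa [one_smul, h.retraction_apply] at this

theorem eq_of_span_image_eq (h : IsScalarExtension ι r ρ) {L M : Submodule F A}
    (hLM : Submodule.span E (ι '' (L : Set A)) = Submodule.span E (ι '' (M : Set A))) : L = M := by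
  ext a
  rw [← h.mem_span_image_iff L, hLM, h.mem_span_image_iff]

theorem mem_span_one_iff [IsScalarTower F E B] [Algebra.IsCentral F A]
    (h : IsScalarExtension ι r ρ) (a : A) :
    ι a ∈ Submodule.span E {1} ↔ a ∈ Subalgebra.center F A := by
  rw [Submodule.mem_span_singleton, Subalgebra.mem_center_iff]
  refine ⟨?_, fun ha => ?_⟩
  · rintro ⟨c, hc⟩ b
    apply h.injective
    rw [map_mul, map_mul, ← hc]
    simp
  · obtain ⟨c, hc⟩ := Algebra.IsCentral.out (K := F) (Subalgebra.mem_center_iff.2 ha)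
    refine ⟨algebraMap F E c, ?_⟩
    have hc' : algebraMap F A c = a := hc
    rw [← hc', AlgHom.commutes, algebraMap_smul, Algebra.algebraMap_eq_smul_one]

theorem eq_bot_of_span_image_eq_bot (h : IsScalarExtension ι r ρ) {L : Submodule F A}
    (hL : Submodule.span E (ι '' (L : Set A)) = ⊥) : L = ⊥ := by
  refine h.eq_of_span_image_eq (hL.trans ?_)
  simp

theorem eq_top_of_span_image_eq_top (h : IsScalarExtension ι r ρ) {L : Submodule F A}
    (hL : Submodule.span E (ι '' (L : Set A)) = ⊤) : L = ⊤ := by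
  refine h.eq_of_span_image_eq (hL.trans ?_)
  rw [Submodule.top_coe, Set.image_univ, h.span_range]

theorem eq_center_of_span_image_eq [IsScalarTower F E B] [Algebra.IsCentral F A]
    (h : IsScalarExtension ι r ρ) {L : Submodule F A}
    (hL : Submodule.span E (ι '' (L : Set A)) = Submodule.span E {1}) :
    L = Subalgebra.toSubmodule (Subalgebra.center F A) := by
  ext a
  rw [← h.mem_span_image_iff L, hL, h.mem_span_one_iff, Subalgebra.mem_toSubmodule]

theorem eq_commSpan_univ_of_span_image_eq [IsScalarTower F E B]
    (h : IsScalarExtension ι r ρ) {L : Submodule F A}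
    (hL : Submodule.span E (ι '' (L : Set A)) = commSpan E Set.univ Set.univ) :
    L = commSpan F Set.univ Set.univ := by
  refine h.eq_of_span_image_eq (hL.trans ?_)
  rw [← commSpan_span_image, Set.image_univ, h.span_range, Submodule.top_coe]

variable [StarRing A] {τ : B →ₗ[E] B}

theorem map_mul_reverse (h : IsScalarExtension ι r ρ) (hτ : ∀ a, τ (ι a) = ι (star a)) (x y : B) :
    τ (x * y) = τ y * τ x := by
  have hx : x ∈ Submodule.span E (Set.range ι) := h.span_range ▸ Submodule.mem_top
  have hy : y ∈ Submodule.span E (Set.range ι) := h.span_range ▸ Submodule.mem_top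
  induction hx using Submodule.span_induction with
  | zero => simp
  | add x x' _ _ hx hx' => rw [add_mul, map_add, map_add, hx, hx', mul_add]
  | smul c x _ hx => rw [smul_mul_assoc, map_smul, map_smul, hx, mul_smul_comm]
  | mem x hx =>
    obtain ⟨a, rfl⟩ := hx
    induction hy using Submodule.span_induction with
    | zero => simp
    | add x x' _ _ hx hx' => rw [mul_add, map_add, map_add, hx, hx', add_mul]
    | smul c x _ hx => rw [mul_smul_comm, map_smul, map_smul, hx, smul_mul_assoc]
    | mem y hy =>
      obtain ⟨b, rfl⟩ := hy
      rw [← map_mul, hτ, hτ, hτ, star_mul, map_mul]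

theorem involutive (h : IsScalarExtension ι r ρ) (hτ : ∀ a, τ (ι a) = ι (star a)) (x : B) :
    τ (τ x) = x := by
  have hx : x ∈ Submodule.span E (Set.range ι) := h.span_range ▸ Submodule.mem_top
  induction hx using Submodule.span_induction with
  | zero => simp
  | add x x' _ _ hx hx' => rw [map_add, map_add, hx, hx']
  | smul c x _ hx => rw [map_smul, map_smul, hx]
  | mem x hx =>
    obtain ⟨a, rfl⟩ := hx
    rw [hτ, hτ, star_star]

theorem symmPart_eq (h : IsScalarExtension ι r ρ) (h2 : (2 : E) ≠ 0)
    (hτ : ∀ a, τ (ι a) = ι (star a)) :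
    symmPart τ = Submodule.span E (ι '' (selfAdjoint A : Set A)) := by
  refine le_antisymm (fun x hx => ?_) (Submodule.span_le.2 ?_)
  · have key : ∀ y, y + τ y ∈ Submodule.span E (ι '' (selfAdjoint A : Set A)) := by
      intro y
      have hy : y ∈ Submodule.span E (Set.range ι) := h.span_range ▸ Submodule.mem_top
      induction hy using Submodule.span_induction with
      | zero => simp
      | add x y _ _ hx hy =>
        rw [map_add, add_add_add_comm]
        exact Submodule.add_mem _ hx hy
      | smul c x _ hx =>
        rw [map_smul, ← smul_add]
        exact Submodule.smul_mem _ _ hx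
      | mem x hx =>
        obtain ⟨a, rfl⟩ := hx
        rw [hτ, ← map_add]
        exact Submodule.subset_span ⟨_, IsSelfAdjoint.add_star_self a, rfl⟩
    have h1 := Submodule.smul_mem _ (2 : E)⁻¹ (key x)
    rwa [mem_symmPart.1 hx, ← two_smul E x, smul_smul, inv_mul_cancel₀ h2, one_smul] at h1
  · rintro _ ⟨a, ha, rfl⟩
    change τ (ι a) = ι a
    rw [hτ, selfAdjoint.mem_iff.1 ha]

theorem skewPart_eq (h : IsScalarExtension ι r ρ) (h2 : (2 : E) ≠ 0)
    (hτ : ∀ a, τ (ι a) = ι (star a)) :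
    skewPart τ = Submodule.span E (ι '' (skewAdjoint A : Set A)) := by
  refine le_antisymm (fun x hx => ?_) (Submodule.span_le.2 ?_)
  · have key : ∀ y, y - τ y ∈ Submodule.span E (ι '' (skewAdjoint A : Set A)) := by
      intro y
      have hy : y ∈ Submodule.span E (Set.range ι) := h.span_range ▸ Submodule.mem_top
      induction hy using Submodule.span_induction with
      | zero => simp
      | add x y _ _ hx hy =>
        rw [map_add, add_sub_add_comm]
        exact Submodule.add_mem _ hx hy
      | smul c x _ hx =>
        rw [map_smul, ← smul_sub]
        exact Submodule.smul_mem _ _ hx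
      | mem x hx =>
        obtain ⟨a, rfl⟩ := hx
        rw [hτ, ← map_sub]
        refine Submodule.subset_span ⟨_, ?_, rfl⟩
        change star (a - star a) = -(a - star a)
        rw [star_sub, star_star, neg_sub]
    have h1 := Submodule.smul_mem _ (2 : E)⁻¹ (key x)
    rwa [mem_skewPart.1 hx, sub_neg_eq_add, ← two_smul E x, smul_smul, inv_mul_cancel₀ h2,
      one_smul] at h1
  · rintro _ ⟨a, ha, rfl⟩
    change τ (ι a) = -ι a
    rw [hτ, skewAdjoint.mem_iff.1 ha, map_neg]

theorem isSkewStable [IsScalarTower F E B] (h : IsScalarExtension ι r ρ) (h2 : (2 : E) ≠ 0)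
    (hτ : ∀ a, τ (ι a) = ι (star a)) {L : Submodule F A} (hL : IsLieSkewIdeal L) :
    IsSkewStable τ (Submodule.span E (ι '' (L : Set A))) := by
  intro x hx k hk
  rw [h.skewPart_eq h2 hτ] at hk
  have h1 := commutator_mem_commSpan (E := E) hx hk
  rw [commSpan_span_image] at h1
  refine Submodule.span_mono (Set.image_mono (Submodule.span_le.2 ?_)) h1
  rintro _ ⟨u, hu, v, hv, rfl⟩
  exact hL u hu v hv

/-- The classification over `E` descends to `A`. -/
theorem classification_firstKind [IsScalarTower F E B] [Algebra.IsCentral F A]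
    (h : IsScalarExtension ι r ρ)
    (h2 : (2 : E) ≠ 0) (hτ : ∀ a, τ (ι a) = ι (star a)) (hdich : HasSkewStableDichotomy τ)
    {L : Submodule F A} (hL : IsLieSkewIdeal L) :
    L = ⊥ ∨ L = Subalgebra.toSubmodule (Subalgebra.center F A) ∨
      L.toAddSubgroup = skewAdjoint A ∨
      L = commSpan F (selfAdjoint A : Set A) (skewAdjoint A : Set A) ∨
      L.toAddSubgroup = selfAdjoint A ∨
      L.toAddSubgroup = (Subring.center A).toAddSubgroup ⊔ skewAdjoint A ∨
      L = commSpan F (Set.univ : Set A) (Set.univ : Set A) ∨ L = ⊤ := by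
  have hskew : ∀ a, ι a ∈ skewPart τ ↔ a ∈ skewAdjoint A := fun a => by
    rw [mem_skewPart, hτ, skewAdjoint.mem_iff, ← map_neg, h.injective.eq_iff]
  have hsymm : ∀ a, ι a ∈ symmPart τ ↔ a ∈ selfAdjoint A := fun a => by
    rw [mem_symmPart, hτ, selfAdjoint.mem_iff, h.injective.eq_iff]
  rcases hdich.classification h2 (h.map_mul_reverse hτ) (h.involutive hτ)
    (h.isSkewStable h2 hτ hL) with hW | hW | hW | hW | hW | hW | hW | hW
  · exact Or.inl (h.eq_bot_of_span_image_eq_bot hW)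
  · exact Or.inr (Or.inl (h.eq_center_of_span_image_eq hW))
  · refine Or.inr (Or.inr (Or.inl ?_))
    ext a
    rw [Submodule.mem_toAddSubgroup, ← h.mem_span_image_iff L, hW, hskew]
  · refine Or.inr (Or.inr (Or.inr (Or.inl (h.eq_of_span_image_eq (hW.trans ?_)))))
    rw [h.symmPart_eq h2 hτ, h.skewPart_eq h2 hτ, commSpan_span_image]
  · refine Or.inr (Or.inr (Or.inr (Or.inr (Or.inl ?_))))
    ext a
    rw [Submodule.mem_toAddSubgroup, ← h.mem_span_image_iff L, hW, hsymm]
  · refine Or.inr (Or.inr (Or.inr (Or.inr (Or.inr (Or.inl ?_)))))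
    ext a
    rw [Submodule.mem_toAddSubgroup, ← h.mem_span_image_iff L, hW]
    constructor
    · intro ha
      obtain ⟨x, hx, k, hk, hxk⟩ := Submodule.mem_sup.1 ha
      have hτ1 : τ 1 = 1 := by rw [← _root_.map_one ι, hτ, star_one]
      -- The sum `a + star a` is twice the symmetric part of `a`, and its image is a scalar.
      have hb : a + star a ∈ Subalgebra.center F A := by
        rw [← h.mem_span_one_iff, map_add, ← hτ, ← hxk, map_add, mem_skewPart.1 hk]
        obtain ⟨c, rfl⟩ := Submodule.mem_span_singleton.1 hx
        rw [map_smul, hτ1]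
        have : c • (1 : B) + k + (c • 1 + -k) = (2 * c) • 1 := by module
        rw [this]
        exact Submodule.smul_mem _ _ (Submodule.mem_span_singleton_self _)
      have h2F : (2 : F) ≠ 0 := fun h0 => h2 (by
        rw [← map_ofNat (algebraMap F E) 2, h0, map_zero])
      have hs : (2 : F)⁻¹ • (a + star a) ∈ Subalgebra.center F A := Subalgebra.smul_mem _ hb _
      have ha' : a = (2 : F)⁻¹ • (a + star a) + (a - (2 : F)⁻¹ • (a + star a)) := by abel
      rw [ha']
      refine AddSubgroup.add_mem_sup (show _ ∈ Subring.center A from hs) ?_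
      rw [← hskew, mem_skewPart, map_sub, map_smul, map_add, ← hτ, map_sub]
      rw [← algebraMap_smul E (2 : F)⁻¹ (ι a + τ (ι a)), map_smul, map_add, h.involutive hτ,
        map_inv₀, map_ofNat]
      rw [add_comm (τ (ι a)), neg_sub, sub_eq_sub_iff_add_eq_add, ← smul_add]
      have h3 : (2 : E)⁻¹ • (ι a + τ (ι a) + (ι a + τ (ι a))) = ι a + τ (ι a) := by
        rw [← two_smul E (ι a + τ (ι a)), smul_smul, inv_mul_cancel₀ h2, one_smul]
      rw [h3, add_comm]
    · intro ha
      obtain ⟨z, hz, k, hk, rfl⟩ := AddSubgroup.mem_sup.1 ha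
      rw [map_add]
      exact Submodule.add_mem_sup ((h.mem_span_one_iff z).2 hz) ((hskew k).2 hk)
  · exact Or.inr (Or.inr (Or.inr (Or.inr (Or.inr (Or.inr (Or.inl
      (h.eq_commSpan_univ_of_span_image_eq hW)))))))
  · exact Or.inr (Or.inr (Or.inr (Or.inr (Or.inr (Or.inr (Or.inr
      (h.eq_top_of_span_image_eq_top hW)))))))

end IsScalarExtension

end Descent

/-! ### Lie skew-ideals of central simple algebras -/

section Kinds

open Matrix

variable {F A : Type*} [Field F] [Ring A] [Algebra F A] [StarRing A]

/-- An involution of the first kind is linear over the centre. -/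
theorem IsFirstKind.star_smul (h1 : IsFirstKind A) (c : F) (a : A) : star (c • a) = c • star a := by
  have hc : star (algebraMap F A c) = algebraMap F A c :=
    h1 _ (Subring.mem_center_iff.2 fun b => (Algebra.commutes c b).symm)
  rw [Algebra.smul_def, star_mul, hc, Algebra.smul_def, Algebra.commutes]

/-- For an involution of the second kind `A` is spanned by its skew elements, so that a Lie
skew-ideal is a Lie ideal. -/
theorem IsLieSkewIdeal.isLieIdeal_of_isSecondKind [Algebra.IsCentral F A] (h2 : (2 : F) ≠ 0)
    (hsec : IsSecondKind A) {L : Submodule F A} (hL : IsLieSkewIdeal L) :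
    ∀ x ∈ L, ∀ a : A, x * a - a * x ∈ L := by
  have hsec' : ∃ z ∈ Subring.center A, star z ≠ z := by
    by_contra! h
    exact hsec h
  obtain ⟨z, hz, hne⟩ := hsec'
  have hstarz : star z ∈ Subring.center A := by
    rw [Subring.mem_center_iff] at hz ⊢
    intro b
    rw [← star_star b, ← star_mul, ← star_mul, hz]
  have hlam : z - star z ∈ Subalgebra.center F A := Subring.sub_mem _ hz hstarz
  obtain ⟨d, hd⟩ := Algebra.IsCentral.out (K := F) hlam
  have hd' : algebraMap F A d = z - star z := hd
  have hd0 : d ≠ 0 := by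
    rintro rfl
    rw [map_zero] at hd'
    exact hne (sub_eq_zero.1 hd'.symm).symm
  intro x hx a
  have hk : x * (a - star a) - (a - star a) * x ∈ L := hL x hx _ (by
    rw [skewAdjoint.mem_iff, star_sub, star_star, neg_sub])
  have hs : x * (a + star a) - (a + star a) * x ∈ L := by
    have h1 := hL x hx (d • (a + star a)) (by
      rw [skewAdjoint.mem_iff, Algebra.smul_def, star_mul, hd', star_sub, star_add, star_star,
        star_star, ← neg_sub z, mul_neg, add_comm (star a), ← hd', Algebra.commutes])
    rw [mul_smul_comm, smul_mul_assoc, ← smul_sub] at h1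
    have := L.smul_mem d⁻¹ h1
    rwa [smul_smul, inv_mul_cancel₀ hd0, one_smul] at this
  have h3 := L.smul_mem (2 : F)⁻¹ (L.add_mem hk hs)
  have h4 : x * (a - star a) - (a - star a) * x + (x * (a + star a) - (a + star a) * x) =
      (2 : F) • (x * a - a * x) := by
    rw [two_smul]
    noncomm_ring
  rwa [h4, smul_smul, inv_mul_cancel₀ h2, one_smul] at h3

/-- The conjugation `a ↦ k a h` by an invertible matrix `k` with inverse `h`. -/
def conjMatrix {E : Type*} [Field E] {n : ℕ} {h k : Matrix (Fin n) (Fin n) E} (hhk : h * k = 1)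
    (hkh : k * h = 1) : Matrix (Fin n) (Fin n) E ≃ₐ[E] Matrix (Fin n) (Fin n) E :=
  have cancel : ∀ {p q : Matrix (Fin n) (Fin n) E}, p * q = 1 → ∀ a, p * (q * a * p) * q = a :=
    fun {p q} hpq a => by
      rw [Matrix.mul_assoc q, ← Matrix.mul_assoc p q, hpq, one_mul, Matrix.mul_assoc, hpq, mul_one]
  AlgEquiv.ofLinearEquiv
    { toFun := fun a => k * a * h
      invFun := fun a => h * a * k
      map_add' := fun a b => by rw [mul_add, add_mul]
      map_smul' := fun c a => by simp
      left_inv := fun a => cancel hhk a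
      right_inv := fun a => cancel hkh a }
    (by simp [hkh])
    (fun a b => by
      change k * (a * b) * h = k * a * h * (k * b * h)
      calc k * (a * b) * h = k * a * (1 * b) * h := by simp only [one_mul, Matrix.mul_assoc]
        _ = k * a * h * (k * b * h) := by rw [← hhk]; simp only [Matrix.mul_assoc])

end Kinds

theorem corollary3p16 {F A : Type*} [Field F] [Ring A] [Algebra F A] [FiniteDimensional F A]
    [Algebra.IsCentral F A] [IsSimpleRing A] [StarRing A]
    (L : Submodule F A) (hL : IsLieSkewIdeal L) :
    (IsFirstKind A → Module.finrank F A ≠ 4 → Module.finrank F A ≠ 16 →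
      ringChar F ≠ 2 → ringChar F ≠ 3 →
        L = ⊥ ∨
        L = Subalgebra.toSubmodule (Subalgebra.center F A) ∨
        L.toAddSubgroup = skewAdjoint A ∨
        L = commSpan F (selfAdjoint A : Set A) (skewAdjoint A : Set A) ∨
        L.toAddSubgroup = selfAdjoint A ∨
        L.toAddSubgroup = (Subring.center A).toAddSubgroup ⊔ skewAdjoint A ∨
        L = commSpan F (Set.univ : Set A) (Set.univ : Set A) ∨
        L = ⊤) ∧
    (IsSecondKind A → ringChar F ≠ 2 →
        L = ⊥ ∨
        L = Subalgebra.toSubmodule (Subalgebra.center F A) ∨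
        L = commSpan F (Set.univ : Set A) (Set.univ : Set A) ∨
        L = ⊤) := by
  let E := AlgebraicClosure F
  obtain ⟨n, ι, r, ρ, hn, hr, hspan, hρ, hext⟩ := exists_splitting F E A
  have hι : IsScalarExtension ι r ρ := ⟨hr, hspan, hρ⟩
  have ofNat_ne : ∀ m : ℕ, (m : F) ≠ 0 → (m : E) ≠ 0 := fun m hm => by
    rw [← map_natCast (algebraMap F E) m]
    exact (map_ne_zero _).2 hm
  refine ⟨fun hfirst hn4 hn16 hc2 hc3 => ?_, fun hsec hc2 => ?_⟩
  · have h2 : (2 : E) ≠ 0 := by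
      exact_mod_cast ofNat_ne 2 (by exact_mod_cast Ring.two_ne_zero hc2)
    have h3 : (3 : E) ≠ 0 := by
      refine mod_cast ofNat_ne 3 fun h => ?_
      rcases (Nat.dvd_prime Nat.prime_three).1 ((ringChar.spec F 3).1 h) with h | h
      · exact CharP.ringChar_ne_one h
      · exact hc3 h
    -- In dimension one there are no subspaces besides `⊥` and `⊤`; the dichotomy fails there.
    by_cases hn1 : n = 1
    · have hfin : Module.finrank F A = 1 := by rw [← hn, hn1]
      have hle := L.finrank_le
      rw [hfin] at hle
      rcases Nat.le_one_iff_eq_zero_or_eq_one.1 hle with h | h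
      · exact Or.inl (Submodule.finrank_eq_zero.1 h)
      · simp [Submodule.eq_top_of_finrank_eq (h.trans hfin.symm)]
    have hn0 : n ≠ 0 := by
      rintro rfl
      have := Module.finrank_pos (R := F) (M := A)
      omega
    have hn2 : n ≠ 2 := by
      rintro rfl
      exact hn4 hn.symm
    have hn4' : n ≠ 4 := by
      rintro rfl
      exact hn16 hn.symm
    obtain ⟨τ, hτ⟩ := hext
      { toFun := star
        map_add' := star_add
        map_smul' := hfirst.star_smul }
    have hτ' : ∀ a, τ (ι a) = ι (star a) := hτ
    rcases Matrix.involution_classification h2 τ (hι.map_mul_reverse hτ')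
      (by rw [← map_one ι, hτ', star_one]) (hι.involutive hτ') with
      ⟨h, k, hhk, hkh, hτt⟩ | ⟨G, H, hGH, hHG, hH, hτG⟩
    -- In the first case the splitting is changed so that the involution becomes the transpose.
    · let ψ := conjMatrix hhk hkh
      have hι' : IsScalarExtension ((ψ.toAlgHom.restrictScalars F).comp ι) r
          (ρ ∘ₗ (ψ.symm.toLinearMap.restrictScalars F)) := by
        refine ⟨hr, ?_, fun e a => ?_⟩
        · have : Set.range ((ψ.toAlgHom.restrictScalars F).comp ι) =
              ψ.toLinearMap '' Set.range ι := by
            rw [← Set.range_comp]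
            rfl
          rw [this, Submodule.span_image, hspan, Submodule.map_top, LinearMap.range_eq_top]
          exact ψ.surjective
        · rw [← hρ]
          simp
      refine hι'.classification_firstKind h2 (τ := transposeLin E n) (fun a => ?_)
        (hasSkewStableDichotomy_transposeLin h2 h3 (by omega)) hL
      change Matrix.transpose (k * ι a * h) = k * ι (star a) * h
      rw [← hτt, hτ']
    · exact hι.classification_firstKind h2 hτ'
        (hasSkewStableDichotomy_of_transpose_eq_neg h2 (by omega) hGH hHG hH τ hτG) hL
  · have h2F : (2 : F) ≠ 0 := Ring.two_ne_zero hc2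
    have h2 : (2 : E) ≠ 0 := by exact_mod_cast ofNat_ne 2 (by exact_mod_cast h2F)
    have hideal := hL.isLieIdeal_of_isSecondKind h2F hsec
    have hW : ∀ x ∈ Submodule.span E (ι '' (L : Set A)), ∀ a,
        x * a - a * x ∈ Submodule.span E (ι '' (L : Set A)) := by
      intro x hx a
      have ha : a ∈ Submodule.span E (ι '' Set.univ) := by
        rw [Set.image_univ, hspan]
        trivial
      have h1 := commutator_mem_commSpan (E := E) hx ha
      rw [commSpan_span_image] at h1
      refine Submodule.span_mono (Set.image_mono (Submodule.span_le.2 ?_)) h1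
      rintro _ ⟨u, hu, v, -, rfl⟩
      exact hideal u hu v
    rcases lieIdeal_classification h2 hW with h | h | h | h
    · exact Or.inl (hι.eq_bot_of_span_image_eq_bot h)
    · exact Or.inr (Or.inl (hι.eq_center_of_span_image_eq h))
    · exact Or.inr (Or.inr (Or.inl (hι.eq_commSpan_univ_of_span_image_eq h)))
    · exact Or.inr (Or.inr (Or.inr (hι.eq_top_of_span_image_eq_top h)))
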